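/- For $\alpha,\nu\in\mathbb{R}$ let $W_{\alpha,\nu}$ be the Whittaker function of the second kind, i.e. the solution on $(0,\infty)$ of $u''(x)+\bigl(-\tfrac14+\tfrac{\alpha}{x}+\tfrac{1/4-\nu^2}{x^2}\bigr)u(x)=0$ determined by $u(x)\sim x^{\alpha}e^{-x/2}$ as $x\to\infty$, and let $D_\mu(z)=2^{\frac{\mu}{2}+\frac14}z^{-\frac12}W_{\frac{\mu}{2}+\frac14,\frac14}\bigl(\tfrac{z^2}{2}\bigr)$ ($z>0$) be the parabolic cylinder function. For $a\ge 0$ and $x,y,\xi>0$ put $\mathrm{m}_a(\xi)=\xi^{-2a-1}e^{-\xi}$ and \[ q_a(x,y,\xi)=2^{-\frac32+a}\pi^{-\frac12}(xy\xi)^{a}\exp\Bigl(x+y+\xi-\frac{(xy+x\xi+y\xi)^2}{8xy\xi}\Bigr)D_{1-2a}\Bigl(\frac{xy+x\xi+y\xi}{(2xy\xi)^{1/2}}\Bigr). \] For $1\le p\le\infty$ let $L_p^a=L_p\bigl((0,\infty);\mathrm{m}_a(x)\,dx\bigr)$ with its usual norm $\|\cdot\|_{p,a}$, and for $y>0$ define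 the index Whittaker translation \[ (\mathcal{T}_a^y f)(x)=\int_0^\infty f(\xi)\,q_a(x,y,\xi)\,\mathrm{m}_a(\xi)\,d\xi\qquad(x>0). \] **Proposition.** Fix $a\ge 0$ and $y>0$. Then: (a) If $f\in L_\infty^a$ is such that $0\le f\le 1$ (almost everywhere), then $0\le(\mathcal{T}_a^yf)(x)\le 1$ for every $x>0$. (b) For each $1\le p\le\infty$ and each $f\in L_p^a$, the integral defining $(\mathcal{T}_a^yf)(x)$ converges absolutely for almost every $x>0$, $\mathcal{T}_a^yf\in L_p^a$, and $\|\mathcal{T}_a^yf\|_{p,a}\le\|f\|_{p,a}$. (c) If $f\in L_p^a$ where $1<p\le\infty$, then the integral defining $(\mathcal{T}_a^yf)(x)$ converges absolutely for every $x>0$ and $\mathcal{T}_a^yf$ is continuous on $(0,\infty)$; for $1<p<\infty$ we also have $\lim_{h\to0}\|\mathcal{T}_a^{y+h}f-\mathcal{T}_a^yf\|_{p,a}=0$. (d) If $f$ is bounded and continuous on $(0,\infty)$, then $(\mathcal{T}_a^yf)(x)\to f(y)$ as $x\to\infty$. (e) If $f\in L_\infty^a$ is such that $\lim_{x\to0}f(x)=0$,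 then $\lim_{x\to0}(\mathcal{T}_a^yf)(x)=0$. -/

import Mathlib

open MeasureTheory Filter Topology Set
open scoped ENNReal

noncomputable section

namespace IndexWhittaker

/-- `u` is the Whittaker function of the second kind with parameters `α, ν`: on `(0, ∞)` it solves
`u'' + (-1/4 + α / x + (1/4 - ν ^ 2) / x ^ 2) u = 0` and `u x ∼ x ^ α * exp (-x / 2)` as `x → ∞`.
(The value `0` on `(-∞, 0]` is a convention; only the half line `(0, ∞)` matters.) -/
structure IsWhittakerW (α ν : ℝ) (u : ℝ → ℝ) : Prop where
  ode : ∃ u' : ℝ → ℝ, ∀ x : ℝ, 0 < x →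
    HasDerivAt u (u' x) x ∧
    HasDerivAt u' (-(-1 / 4 + α / x + (1 / 4 - ν ^ 2) / x ^ 2) * u x) x
  asymp : Asymptotics.IsEquivalent atTop u (fun x : ℝ => x ^ α * Real.exp (-x / 2))
  eq_zero : ∀ x : ℝ, x ≤ 0 → u x = 0

/-- The Whittaker function of the second kind `W_{α,ν}` (real parameters, argument in `(0, ∞)`),
i.e. the function determined by `IsWhittakerW α ν`. -/
def whittakerW (α ν : ℝ) : ℝ → ℝ := Classical.epsilon (IsWhittakerW α ν)

/-- The parabolic cylinder function `D_μ(z)`, for `z > 0`. -/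
def parabolicD (μ z : ℝ) : ℝ :=
  2 ^ (μ / 2 + 1 / 4) * z ^ (-(1 / 2) : ℝ) * whittakerW (μ / 2 + 1 / 4) (1 / 4) (z ^ 2 / 2)

/-- The kernel `q_a(x, y, ξ)` of the product formula for the Whittaker function. -/
def kernelQ (a x y ξ : ℝ) : ℝ :=
  2 ^ (-(3 / 2) + a) * Real.pi ^ (-(1 / 2) : ℝ) * (x * y * ξ) ^ a *
    Real.exp (x + y + ξ - (x * y + x * ξ + y * ξ) ^ 2 / (8 * x * y * ξ)) *
    parabolicD (1 - 2 * a) ((x * y + x * ξ + y * ξ) / (2 * x * y * ξ) ^ (1 / 2 : ℝ))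

/-- The weight `m_a(ξ) = ξ ^ (-2 a - 1) e ^ (-ξ)`. -/
def weightM (a ξ : ℝ) : ℝ := ξ ^ (-2 * a - 1) * Real.exp (-ξ)

/-- The measure `m_a(ξ) dξ` on `(0, ∞)`; `L_p^a` is the Lebesgue space of this measure. -/
def measureM (a : ℝ) : Measure ℝ :=
  (volume.restrict (Ioi (0 : ℝ))).withDensity (fun ξ => ENNReal.ofReal (weightM a ξ))

/-- The index Whittaker translation
`(T_a^y f)(x) = ∫_0^∞ f(ξ) q_a(x, y, ξ) m_a(ξ) dξ`. -/
def translation {E : Type*} [NormedAddCommGroup E] [NormedSpace ℝ E]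
    (a y : ℝ) (f : ℝ → E) (x : ℝ) : E :=
  ∫ ξ, kernelQ a x y ξ • f ξ ∂(measureM a)

end IndexWhittaker

end

namespace IndexWhittaker

/-! ### Identification of the Whittaker function -/

/-! Two properties of the kernel carry the theorem: `q_a(x, y, ·)` is a positive density of total
mass 1 for `m_a` (`kernelQ_pos`, `lintegral_kernelQ`), and `q_a` is symmetric in its three
arguments. So the translation averages `f` against a probability measure, which gives (a). Jensen's
inequality and Tonelli's theorem, with the mass in `x` again equal to 1 by symmetry, give the
contraction (b).

The mass is computed from an explicit formula. One has `W_{3/4-a,1/4}(X) = X^{3/4} e^{-X/2} U(a,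
3/2, X)` with Tricomi's function `U` (`whittakerW_eq`), so up to elementary factors the kernel is
`X^{1/2} e^{-X} U(a, 3/2, X)` at `X = (xy + xξ + yξ)² / (4xyξ)` (`kernelQ_eq`). For `a > 0` a
Laplace integral shows `U > 0`; for `a = 0`, `U = 1`. A substitution in `ξ` reduces the mass to
`lintegral_core`: for `a > 0` a beta integral, a gamma integral and Legendre duplication, for `a =
0` a Gaussian integral.

The rest follows from the size of the kernel, read off from `2X = x + y + ξ + (xy/ξ + xξ/y +
yξ/x)/2`. With two arguments in a compact set, the kernel is dominated by a function of the third
that lies in a prescribed `L_q^a`, `q < ∞` (`exists_kernelQ_le`, `memLp_dominating`). Hölder and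
dominated convergence then give continuity in `x`. Norm continuity in `y` is proved for `f` with
support in `[1/M, M]` and extended by density, because the contraction bound does not depend on `y`.
Finally, the mass of the kernel concentrates at `y` as `x → ∞` and at `0` as `x → 0`, so (d) and (e)
are approximate-identity arguments (`tendsto_lintegral_kernelQ_mul`). -/

/-- A Whittaker function that has no zero on `(0, ∞)` is the only one with its parameters. -/
theorem IsWhittakerW.eq_of_pos {α ν : ℝ} {u v : ℝ → ℝ} (hu : IsWhittakerW α ν u)
    (hv : IsWhittakerW α ν v) (hpos : ∀ x, 0 < x → 0 < u x) : v = u := by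
  obtain ⟨u', hu'⟩ := hu.ode
  obtain ⟨v', hv'⟩ := hv.ode
  -- The Wronskian is constant, since the equation has no first-order term.
  have hw : ∀ x ∈ Ioi (0 : ℝ), HasDerivAt (fun x => v' x * u x - v x * u' x) 0 x := by
    intro x hx
    refine (((hv' x hx).2.mul (hu' x hx).1).sub
      ((hv' x hx).1.mul (hu' x hx).2)).congr_deriv ?_
    ring
  obtain ⟨c, hc⟩ : ∃ c, ∀ x ∈ Ioi (0 : ℝ), v' x * u x - v x * u' x = c := by
    refine ⟨_, fun x hx => isOpen_Ioi.is_const_of_deriv_eq_zero isPreconnected_Ioi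
      (fun y hy => (hw y hy).differentiableAt.differentiableWithinAt)
      (fun y hy => (hw y hy).deriv) hx (mem_Ioi.2 one_pos)⟩
  have hr : ∀ x ∈ Ioi (0 : ℝ), HasDerivAt (fun x => v x / u x) (c / u x ^ 2) x := by
    intro x hx
    refine ((hv' x hx).1.div (hu' x hx).1 (hpos x hx).ne').congr_deriv ?_
    rw [← hc x hx]
  have hlim : Tendsto (fun x => v x / u x) atTop (𝓝 1) := by
    have h := hv.asymp.trans hu.asymp.symm
    rwa [Asymptotics.isEquivalent_iff_tendsto_one] at h
    filter_upwards [eventually_gt_atTop 0] with x hx using (hpos x hx).ne'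
  have hu0 : Tendsto u atTop (𝓝 0) := by
    refine hu.asymp.symm.tendsto_nhds ?_
    refine (tendsto_rpow_mul_exp_neg_mul_atTop_nhds_zero α (1 / 2) (by norm_num)).congr ?_
    intro x
    congr 2
    ring
  -- The quotient `v / u` has derivative `c / u²`, which exceeds `|c|` in absolute value once `u <
  -- 1`. But `v / u` converges, so its increments over unit intervals tend to 0; the mean value
  -- theorem excludes `c ≠ 0`.
  have hc0 : c = 0 := by
    by_contra hne
    have hd : Tendsto (fun x => v (x + 1) / u (x + 1) - v x / u x) atTop (𝓝 0) := by
      simpa using (hlim.comp (tendsto_atTop_add_const_right atTop 1 tendsto_id)).sub hlim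
    obtain ⟨N, hN⟩ := eventually_atTop.1 (hu0.eventually (gt_mem_nhds one_pos))
    have hcc := (abs_pos.2 hne)
    have h1 := (hd.abs).eventually (gt_mem_nhds (show |(0 : ℝ)| < |c| by simpa using hne))
    obtain ⟨x, hx1, hx2, hx3⟩ :=
      (h1.and ((eventually_ge_atTop N).and (eventually_gt_atTop 0))).exists
    obtain ⟨z, hz, hz'⟩ := exists_hasDerivAt_eq_slope (fun x => v x / u x) (fun x => c / u x ^ 2)
      (lt_add_one x)
      (fun t ht => (hr t (lt_of_lt_of_le hx3 ht.1)).continuousAt.continuousWithinAt)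
      (fun t ht => hr t (hx3.trans ht.1))
    have hz0 : 0 < u z := hpos z (hx3.trans hz.1)
    have hz1 : u z < 1 := hN z (hx2.trans hz.1.le)
    rw [add_sub_cancel_left, div_one] at hz'
    rw [← hz', abs_div, abs_of_pos (pow_pos hz0 2), div_lt_iff₀ (pow_pos hz0 2)] at hx1
    have : u z ^ 2 < 1 := pow_lt_one₀ hz0.le hz1 two_ne_zero
    nlinarith
  have hconst : ∀ x ∈ Ioi (0 : ℝ), v x / u x = 1 := by
    intro x hx
    refine tendsto_nhds_unique (tendsto_const_nhds.congr' ?_) hlim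
    filter_upwards [eventually_gt_atTop 0] with y hy
    refine isOpen_Ioi.is_const_of_deriv_eq_zero isPreconnected_Ioi
      (fun y hy => (hr y hy).differentiableAt.differentiableWithinAt)
      (fun y hy => ?_) hx hy
    rw [(hr y hy).deriv, hc0, zero_div, Pi.zero_apply]
  funext x
  rcases le_or_gt x 0 with hx | hx
  · rw [hu.eq_zero x hx, hv.eq_zero x hx]
  · exact (div_eq_one_iff_eq (hpos x hx).ne').1 (hconst x hx)

/-- The Whittaker function built from a solution `g` of Kummer's equation
`x g'' + (3 / 2 - x) g' - a g = 0`. -/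
theorem isWhittakerW_of_kummer {a : ℝ} {g g₁ g₂ : ℝ → ℝ}
    (hg : ∀ x, 0 < x → HasDerivAt g (-g₁ x) x) (hg₁ : ∀ x, 0 < x → HasDerivAt g₁ (-g₂ x) x)
    (hode : ∀ x, 0 < x → x * g₂ x + x * g₁ x = a * g x + 3 / 2 * g₁ x)
    (hlim : Tendsto (fun x => x ^ a * g x) atTop (𝓝 1)) :
    IsWhittakerW (3 / 4 - a) (1 / 4)
      (fun x => if 0 < x then x ^ (3 / 4 : ℝ) * Real.exp (-x / 2) * g x else 0) := by
  refine ⟨⟨fun x => x ^ (3 / 4 : ℝ) * Real.exp (-x / 2) * ((3 / 4 / x - 1 / 2) * g x - g₁ x),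
    fun x hx => ?_⟩, ?_, fun x hx => if_neg hx.not_gt⟩
  · have hE : HasDerivAt (fun x : ℝ => x ^ (3 / 4 : ℝ) * Real.exp (-x / 2))
        (x ^ (3 / 4 : ℝ) * Real.exp (-x / 2) * (3 / 4 / x - 1 / 2)) x := by
      have h1 := Real.hasDerivAt_rpow_const (x := x) (p := 3 / 4) (Or.inl hx.ne')
      have h2 : HasDerivAt (fun x : ℝ => Real.exp (-x / 2)) (Real.exp (-x / 2) * (-1 / 2)) x :=
        ((hasDerivAt_id x).neg.div_const 2).exp
      refine (h1.mul h2).congr_deriv ?_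
      rw [Real.rpow_sub_one hx.ne']
      field_simp
      ring
    have hev : (fun x => if 0 < x then x ^ (3 / 4 : ℝ) * Real.exp (-x / 2) * g x else 0) =ᶠ[𝓝 x]
        fun x => x ^ (3 / 4 : ℝ) * Real.exp (-x / 2) * g x := by
      filter_upwards [lt_mem_nhds hx] with y hy using if_pos hy
    constructor
    · refine HasDerivAt.congr_of_eventuallyEq ?_ hev
      refine (hE.mul (hg x hx)).congr_deriv ?_
      ring
    · have hq : HasDerivAt (fun x : ℝ => 3 / 4 / x - 1 / 2) (-(3 / 4) / x ^ 2) x := by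
        refine (((hasDerivAt_const x (3 / 4 : ℝ)).div (hasDerivAt_id x)
          hx.ne').sub_const (1 / 2)).congr_deriv ?_
        simp
      refine (hE.mul ((hq.mul (hg x hx)).sub (hg₁ x hx))).congr_deriv ?_
      rw [if_pos hx]
      have hg₂ : g₂ x = a / x * g x + 3 / 2 / x * g₁ x - g₁ x := by
        field_simp
        linarith [hode x hx]
      simp only [Pi.mul_apply, Pi.sub_apply]
      rw [hg₂]
      field_simp
      ring
  · refine (Asymptotics.isEquivalent_iff_tendsto_one ?_).2 (hlim.congr' ?_)
    · filter_upwards [eventually_gt_atTop 0] with x hx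
      positivity
    · filter_upwards [eventually_gt_atTop 0] with x hx
      rw [Pi.div_apply, if_pos hx, Real.rpow_sub hx]
      field_simp

/-! ### Tricomi's function: Laplace integral, Kummer's equation, asymptotics -/

/-- `Γ(b)` times Tricomi's function `U(b, b + 3 / 2 - a, x)`. -/
noncomputable def kummerInt (a b x : ℝ) : ℝ :=
  ∫ t in Ioi (0 : ℝ), Real.exp (-(x * t)) * t ^ (b - 1) * (1 + t) ^ (1 / 2 - a)

theorem one_add_rpow_le {a t : ℝ} (ha : 0 ≤ a) (ht : 0 ≤ t) : (1 + t) ^ (1 / 2 - a) ≤ 1 + t := by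
  calc (1 + t) ^ (1 / 2 - a) ≤ (1 + t) ^ (1 : ℝ) :=
        Real.rpow_le_rpow_of_exponent_le (by linarith) (by linarith)
    _ = 1 + t := Real.rpow_one _

/-- Here `(1 + t)^{1/2-a} ≥ (1 + t)^{-a} ≥ e^{-at} ≥ 1 - at`. With `one_add_rpow_le` this encloses
the last factor of the Laplace integrand between two linear functions, whose integrals are gamma
functions; that suffices for the leading asymptotics. -/
theorem le_one_add_rpow {a t : ℝ} (ha : 0 ≤ a) (ht : 0 ≤ t) :
    1 - a * t ≤ (1 + t) ^ (1 / 2 - a) := by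
  have h0 : Real.log (1 + t) ≤ t := by
    linarith [Real.log_le_sub_one_of_pos (show 0 < 1 + t by linarith)]
  calc 1 - a * t ≤ Real.exp (-(a * t)) := by linarith [Real.add_one_le_exp (-(a * t))]
    _ ≤ Real.exp (Real.log (1 + t) * -a) := Real.exp_le_exp.2 (by nlinarith)
    _ = (1 + t) ^ (-a) := (Real.rpow_def_of_pos (by linarith) _).symm
    _ ≤ (1 + t) ^ (1 / 2 - a) := Real.rpow_le_rpow_of_exponent_le (by linarith) (by linarith)

theorem integrableOn_exp_mul_rpow {b x : ℝ} (hb : 0 < b) (hx : 0 < x) :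
    IntegrableOn (fun t : ℝ => Real.exp (-(x * t)) * t ^ (b - 1)) (Ioi 0) := by
  refine (integrableOn_rpow_mul_exp_neg_mul_rpow (s := b - 1) (p := 1) (b := x) (by linarith)
    one_pos hx).congr_fun (fun t _ => ?_) measurableSet_Ioi
  simp only [Real.rpow_one]
  rw [mul_comm, neg_mul]

theorem integral_exp_mul_rpow {b x : ℝ} (hb : 0 < b) (hx : 0 < x) :
    ∫ t in Ioi (0 : ℝ), Real.exp (-(x * t)) * t ^ (b - 1) = x ^ (-b) * Real.Gamma b := by
  simp_rw [mul_comm (Real.exp _)]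
  rw [Real.integral_rpow_mul_exp_neg_mul_Ioi hb hx, one_div, Real.inv_rpow hx.le,
    Real.rpow_neg hx.le]

theorem integrableOn_kummer {a b x : ℝ} (ha : 0 ≤ a) (hb : 0 < b) (hx : 0 < x) :
    IntegrableOn (fun t : ℝ => Real.exp (-(x * t)) * t ^ (b - 1) * (1 + t) ^ (1 / 2 - a))
      (Ioi 0) := by
  refine ((integrableOn_exp_mul_rpow hb hx).add
    (integrableOn_exp_mul_rpow (b := b + 1) (by linarith) hx)).mono'
    (Measurable.aestronglyMeasurable (by fun_prop)) ?_
  refine (ae_restrict_mem measurableSet_Ioi).mono fun t ht => ?_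
  have ht' : (0 : ℝ) < t := ht
  rw [Real.norm_of_nonneg (by positivity)]
  simp only [Pi.add_apply]
  rw [add_sub_cancel_right]
  calc Real.exp (-(x * t)) * t ^ (b - 1) * (1 + t) ^ (1 / 2 - a)
      ≤ Real.exp (-(x * t)) * t ^ (b - 1) * (1 + t) := by
        gcongr
        exact one_add_rpow_le ha ht'.le
    _ = _ := by
        rw [Real.rpow_sub_one ht'.ne']
        field_simp

theorem hasDerivAt_kummerInt {a b x : ℝ} (ha : 0 ≤ a) (hb : 0 < b) (hx : 0 < x) :
    HasDerivAt (kummerInt a b) (-kummerInt a (b + 1) x) x := by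
  have h := (hasDerivAt_integral_of_dominated_loc_of_deriv_le
    (μ := volume.restrict (Ioi (0 : ℝ)))
    (F := fun x t => Real.exp (-(x * t)) * t ^ (b - 1) * (1 + t) ^ (1 / 2 - a))
    (F' := fun x t => -(Real.exp (-(x * t)) * t ^ (b + 1 - 1) * (1 + t) ^ (1 / 2 - a)))
    -- On the neighbourhood `(x/2, ∞)` of `x` the exponential is largest at the left end.
    (bound := fun t => Real.exp (-(x / 2 * t)) * t ^ (b + 1 - 1) * (1 + t) ^ (1 / 2 - a))
    (s := Ioi (x / 2)) (x₀ := x) (Ioi_mem_nhds (by linarith))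
    (Eventually.of_forall fun y => Measurable.aestronglyMeasurable (by fun_prop))
    (integrableOn_kummer ha hb hx)
    (Measurable.aestronglyMeasurable (by fun_prop)) ?_
    (integrableOn_kummer ha (by linarith) (by linarith)) ?_).2
  · rwa [integral_neg] at h
  · refine (ae_restrict_mem measurableSet_Ioi).mono fun t ht y hy => ?_
    have ht' : (0 : ℝ) < t := ht
    have hy' : x / 2 < y := hy
    rw [norm_neg, Real.norm_of_nonneg (by positivity)]
    gcongr
  · refine (ae_restrict_mem measurableSet_Ioi).mono fun t ht y hy => ?_
    have ht' : (0 : ℝ) < t := ht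
    have h1 : HasDerivAt (fun y : ℝ => Real.exp (-(y * t))) (Real.exp (-(y * t)) * (-t)) y := by
      simpa using (((hasDerivAt_id y).mul_const t).neg).exp
    refine ((h1.mul_const (t ^ (b - 1))).mul_const ((1 + t) ^ (1 / 2 - a))).congr_deriv ?_
    rw [add_sub_cancel_right, Real.rpow_sub_one ht'.ne']
    field_simp

/-- This is Kummer's equation, as each derivative of the integral raises `b` by 1 and changes the
sign. It comes from integrating the derivative of `e^{-xt} t^a (1 + t)^{3/2-a}` over `(0, ∞)`; the
boundary terms vanish because `a > 0` and `x > 0`. -/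
theorem kummerInt_recurrence {a x : ℝ} (ha : 0 < a) (hx : 0 < x) :
    x * kummerInt a (a + 1 + 1) x + x * kummerInt a (a + 1) x =
      a * kummerInt a a x + 3 / 2 * kummerInt a (a + 1) x := by
  have i0 := integrableOn_kummer ha.le ha hx
  have i1 := integrableOn_kummer ha.le (show 0 < a + 1 by linarith) hx
  have i2 := integrableOn_kummer ha.le (show 0 < a + 1 + 1 by linarith) hx
  have key := integral_Ioi_of_hasDerivAt_of_tendsto (a := 0) (m := 0)
    (f := fun t : ℝ => Real.exp (-(x * t)) * t ^ a * (1 + t) ^ (3 / 2 - a))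
    (f' := fun t : ℝ =>
      (a * (Real.exp (-(x * t)) * t ^ (a - 1) * (1 + t) ^ (1 / 2 - a)) +
      3 / 2 * (Real.exp (-(x * t)) * t ^ (a + 1 - 1) * (1 + t) ^ (1 / 2 - a))) -
      (x * (Real.exp (-(x * t)) * t ^ (a + 1 + 1 - 1) * (1 + t) ^ (1 / 2 - a)) +
      x * (Real.exp (-(x * t)) * t ^ (a + 1 - 1) * (1 + t) ^ (1 / 2 - a)))) ?_ ?_ ?_ ?_
  · rw [integral_sub, integral_add, integral_add, integral_const_mul, integral_const_mul,
      integral_const_mul, integral_const_mul] at key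
    · simp only [Real.zero_rpow ha.ne', mul_zero, zero_mul, sub_zero] at key
      unfold kummerInt
      linarith
    · exact i2.const_mul x
    · exact i1.const_mul x
    · exact i0.const_mul a
    · exact i1.const_mul (3 / 2)
    · exact (i0.const_mul a).add (i1.const_mul (3 / 2))
    · exact (i2.const_mul x).add (i1.const_mul x)
  · refine ContinuousAt.continuousWithinAt ?_
    refine ContinuousAt.mul (ContinuousAt.mul (by fun_prop) ?_) ?_
    · exact Real.continuousAt_rpow_const _ _ (Or.inr ha.le)
    · exact ContinuousAt.rpow_const (by fun_prop) (Or.inl (by norm_num))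
  · intro t ht
    have ht' : (0 : ℝ) < t := ht
    have h1 : HasDerivAt (fun t : ℝ => Real.exp (-(x * t))) (Real.exp (-(x * t)) * (-x)) t := by
      simpa using (((hasDerivAt_id t).const_mul x).neg).exp
    have h2 := Real.hasDerivAt_rpow_const (x := t) (p := a) (Or.inl ht'.ne')
    have h3 : HasDerivAt (fun t : ℝ => (1 + t) ^ (3 / 2 - a))
        ((3 / 2 - a) * (1 + t) ^ (1 / 2 - a)) t := by
      refine (((hasDerivAt_id t).const_add 1).rpow_const (p := 3 / 2 - a)
        (Or.inl (by simp; linarith))).congr_deriv ?_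
      rw [show (3 / 2 - a - 1 : ℝ) = 1 / 2 - a by ring]
      simp
    refine ((h1.mul h2).mul h3).congr_deriv ?_
    have e : (1 + t) ^ (3 / 2 - a) = (1 + t) ^ (1 / 2 - a) * (1 + t) := by
      rw [← Real.rpow_add_one (by positivity)]
      ring_nf
    simp only [Pi.mul_apply]
    rw [e, show a + 1 + 1 - 1 = a + 1 by ring, add_sub_cancel_right, Real.rpow_add_one ht'.ne',
      Real.rpow_sub_one ht'.ne']
    field_simp
    ring
  · exact ((i0.const_mul a).add (i1.const_mul (3 / 2))).sub
      ((i2.const_mul x).add (i1.const_mul x))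
  · have hb : Tendsto (fun t : ℝ => Real.exp (-(x * t)) * t ^ a * (1 + t) ^ 2) atTop (𝓝 0) := by
      have h0 := tendsto_rpow_mul_exp_neg_mul_atTop_nhds_zero a x hx
      have h1 := tendsto_rpow_mul_exp_neg_mul_atTop_nhds_zero (a + 1) x hx
      have h2 := tendsto_rpow_mul_exp_neg_mul_atTop_nhds_zero (a + 2) x hx
      have h := (h0.add (h1.const_mul 2)).add h2
      simp only [mul_zero, add_zero] at h
      refine h.congr' ?_
      filter_upwards [eventually_gt_atTop 0] with t ht
      simp only [show a + 2 = a + 1 + 1 by ring, Real.rpow_add_one ht.ne', neg_mul]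
      ring
    refine squeeze_zero' ?_ ?_ hb
    · filter_upwards [eventually_gt_atTop 0] with t ht
      positivity
    · filter_upwards [eventually_gt_atTop 0] with t ht
      gcongr
      rw [← Real.rpow_natCast]
      refine Real.rpow_le_rpow_of_exponent_le (by linarith) ?_
      push_cast
      linarith

theorem kummerInt_le {a x : ℝ} (ha : 0 < a) (hx : 0 < x) :
    kummerInt a a x ≤ x ^ (-a) * Real.Gamma a * (1 + a / x) := by
  have i0 := integrableOn_exp_mul_rpow ha hx
  have i1 := integrableOn_exp_mul_rpow (show 0 < a + 1 by linarith) hx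
  calc kummerInt a a x
      ≤ ∫ t in Ioi (0 : ℝ), (Real.exp (-(x * t)) * t ^ (a - 1) +
          Real.exp (-(x * t)) * t ^ (a + 1 - 1)) := by
        refine setIntegral_mono_on (integrableOn_kummer ha.le ha hx) (i0.add i1)
          measurableSet_Ioi fun t ht => ?_
        have ht' : (0 : ℝ) < t := ht
        have := mul_le_mul_of_nonneg_left (one_add_rpow_le ha.le ht'.le)
          (show 0 ≤ Real.exp (-(x * t)) * t ^ (a - 1) by positivity)
        refine this.trans (le_of_eq ?_)
        rw [add_sub_cancel_right, Real.rpow_sub_one ht'.ne']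
        field_simp
    _ = _ := by
        rw [integral_add i0 i1, integral_exp_mul_rpow ha hx, integral_exp_mul_rpow (by linarith) hx,
          Real.Gamma_add_one ha.ne', neg_add, Real.rpow_add hx, Real.rpow_neg_one]
        field_simp

theorem le_kummerInt {a x : ℝ} (ha : 0 < a) (hx : 0 < x) :
    x ^ (-a) * Real.Gamma a * (1 - a ^ 2 / x) ≤ kummerInt a a x := by
  have i0 := integrableOn_exp_mul_rpow ha hx
  have i1 := integrableOn_exp_mul_rpow (show 0 < a + 1 by linarith) hx
  calc x ^ (-a) * Real.Gamma a * (1 - a ^ 2 / x)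
      = ∫ t in Ioi (0 : ℝ), (Real.exp (-(x * t)) * t ^ (a - 1) -
          a * (Real.exp (-(x * t)) * t ^ (a + 1 - 1))) := by
        rw [integral_sub i0 (i1.const_mul a), integral_const_mul, integral_exp_mul_rpow ha hx,
          integral_exp_mul_rpow (by linarith) hx,
          Real.Gamma_add_one ha.ne', neg_add, Real.rpow_add hx, Real.rpow_neg_one]
        field_simp
    _ ≤ _ := by
        refine setIntegral_mono_on (i0.sub (i1.const_mul a)) (integrableOn_kummer ha.le ha hx)
          measurableSet_Ioi fun t ht => ?_
        have ht' : (0 : ℝ) < t := ht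
        have := mul_le_mul_of_nonneg_left (le_one_add_rpow ha.le ht'.le)
          (show 0 ≤ Real.exp (-(x * t)) * t ^ (a - 1) by positivity)
        refine le_trans (le_of_eq ?_) this
        rw [add_sub_cancel_right, Real.rpow_sub_one ht'.ne']
        field_simp

theorem kummerInt_pos {a x : ℝ} (ha : 0 < a) (hx : 0 < x) : 0 < kummerInt a a x := by
  refine (setIntegral_pos_iff_support_of_nonneg_ae ?_ (integrableOn_kummer ha.le ha hx)).2 ?_
  · refine (ae_restrict_mem measurableSet_Ioi).mono fun t ht => ?_
    have ht' : (0 : ℝ) < t := ht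
    simp only [Pi.zero_apply]
    positivity
  · refine lt_of_lt_of_le (b := volume (Ioi (0 : ℝ))) (by simp) (measure_mono fun t ht => ?_)
    have ht' : (0 : ℝ) < t := ht
    refine ⟨?_, ht⟩
    rw [Function.mem_support]
    positivity

/-- Tricomi's function `U(a, 3 / 2, x)`. -/
noncomputable def tricomi (a x : ℝ) : ℝ := if a = 0 then 1 else kummerInt a a x / Real.Gamma a

theorem tricomi_of_pos {a : ℝ} (ha : 0 < a) (x : ℝ) :
    tricomi a x = kummerInt a a x / Real.Gamma a := if_neg ha.ne'

theorem tricomi_zero (x : ℝ) : tricomi 0 x = 1 := if_pos rfl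

theorem tricomi_pos {a x : ℝ} (ha : 0 ≤ a) (hx : 0 < x) : 0 < tricomi a x := by
  rcases ha.eq_or_lt with rfl | ha
  · simp [tricomi_zero]
  · rw [tricomi_of_pos ha]
    exact div_pos (kummerInt_pos ha hx) (Real.Gamma_pos_of_pos ha)

theorem tricomi_le {a x : ℝ} (ha : 0 ≤ a) (hx : 0 < x) :
    tricomi a x ≤ x ^ (-a) * (1 + a / x) := by
  rcases ha.eq_or_lt with rfl | ha
  · simp [tricomi_zero]
  · rw [tricomi_of_pos ha, div_le_iff₀ (Real.Gamma_pos_of_pos ha)]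
    exact (kummerInt_le ha hx).trans (le_of_eq (by ring))

theorem le_tricomi {a x : ℝ} (ha : 0 ≤ a) (hx : 0 < x) :
    x ^ (-a) * (1 - a ^ 2 / x) ≤ tricomi a x := by
  rcases ha.eq_or_lt with rfl | ha
  · simp [tricomi_zero]
  · rw [tricomi_of_pos ha, le_div_iff₀ (Real.Gamma_pos_of_pos ha)]
    exact (le_of_eq (by ring)).trans (le_kummerInt ha hx)

theorem tendsto_rpow_mul_tricomi {a : ℝ} (ha : 0 ≤ a) :
    Tendsto (fun x => x ^ a * tricomi a x) atTop (𝓝 1) := by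
  have h1 : Tendsto (fun x : ℝ => 1 - a ^ 2 / x) atTop (𝓝 1) := by
    simpa using (tendsto_const_nhds (x := (1 : ℝ))).sub
      (tendsto_const_nhds (x := a ^ 2).div_atTop tendsto_id)
  have h2 : Tendsto (fun x : ℝ => 1 + a / x) atTop (𝓝 1) := by
    simpa using (tendsto_const_nhds (x := (1 : ℝ))).add
      (tendsto_const_nhds (x := a).div_atTop tendsto_id)
  refine tendsto_of_tendsto_of_tendsto_of_le_of_le' h1 h2 ?_ ?_
  · filter_upwards [eventually_gt_atTop 0] with x hx
    have := mul_le_mul_of_nonneg_left (le_tricomi ha hx) (Real.rpow_nonneg hx.le a)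
    rwa [← mul_assoc, ← Real.rpow_add hx, add_neg_cancel, Real.rpow_zero, one_mul] at this
  · filter_upwards [eventually_gt_atTop 0] with x hx
    have := mul_le_mul_of_nonneg_left (tricomi_le ha hx) (Real.rpow_nonneg hx.le a)
    rwa [← mul_assoc, ← Real.rpow_add hx, add_neg_cancel, Real.rpow_zero, one_mul] at this

theorem isWhittakerW_tricomi {a : ℝ} (ha : 0 ≤ a) :
    IsWhittakerW (3 / 4 - a) (1 / 4)
      (fun x => if 0 < x then x ^ (3 / 4 : ℝ) * Real.exp (-x / 2) * tricomi a x else 0) := by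
  rcases ha.eq_or_lt with rfl | ha'
  · refine isWhittakerW_of_kummer (g₁ := 0) (g₂ := 0) (fun x _ => ?_) (fun x _ => ?_) ?_
      (tendsto_rpow_mul_tricomi le_rfl)
    · rw [show tricomi 0 = fun _ => 1 from funext tricomi_zero]
      exact (hasDerivAt_const x (1 : ℝ)).congr_deriv (by simp)
    · exact (hasDerivAt_const x (0 : ℝ)).congr_deriv (by simp)
    · simp
  · have e : tricomi a = fun x => kummerInt a a x / Real.Gamma a := funext (tricomi_of_pos ha')
    refine isWhittakerW_of_kummer (g₁ := fun x => kummerInt a (a + 1) x / Real.Gamma a)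
      (g₂ := fun x => kummerInt a (a + 1 + 1) x / Real.Gamma a)
      (fun x hx => ?_) (fun x hx => ?_) (fun x hx => ?_) (tendsto_rpow_mul_tricomi ha)
    · rw [e, ← neg_div]
      exact (hasDerivAt_kummerInt ha ha' hx).div_const _
    · rw [← neg_div]
      exact (hasDerivAt_kummerInt ha (by linarith) hx).div_const _
    · have := kummerInt_recurrence ha' hx
      rw [e]
      field_simp
      linarith

theorem isWhittakerW_whittakerW {a : ℝ} (ha : 0 ≤ a) :
    IsWhittakerW (3 / 4 - a) (1 / 4) (whittakerW (3 / 4 - a) (1 / 4)) :=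
  Classical.epsilon_spec ⟨_, isWhittakerW_tricomi ha⟩

/-- The Tricomi expression witnesses existence, so the chosen function has the defining properties;
being positive, the expression is then the only candidate. -/
theorem whittakerW_eq {a : ℝ} (ha : 0 ≤ a) : whittakerW (3 / 4 - a) (1 / 4) =
    fun x => if 0 < x then x ^ (3 / 4 : ℝ) * Real.exp (-x / 2) * tricomi a x else 0 := by
  refine (isWhittakerW_tricomi ha).eq_of_pos (isWhittakerW_whittakerW ha) fun x hx => ?_
  have := tricomi_pos ha hx
  rw [if_pos hx]
  positivity

theorem continuousOn_tricomi {a : ℝ} (ha : 0 ≤ a) : ContinuousOn (tricomi a) (Ioi 0) := by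
  intro x hx
  rcases ha.eq_or_lt with rfl | ha'
  · rw [show tricomi 0 = fun _ => 1 from funext tricomi_zero]
    exact continuousWithinAt_const
  · rw [show tricomi a = fun x => kummerInt a a x / Real.Gamma a from funext (tricomi_of_pos ha')]
    exact ((hasDerivAt_kummerInt ha ha' hx).div_const _).continuousAt.continuousWithinAt

/-! ### Normalization of the kernel -/

/-- The argument `(xy + xξ + yξ)² / (4xyξ)` of Tricomi's function in the kernel. -/
noncomputable def kernelArg (x y ξ : ℝ) : ℝ := (x * y + x * ξ + y * ξ) ^ 2 / (4 * x * y * ξ)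

theorem kernelArg_pos {x y ξ : ℝ} (hx : 0 < x) (hy : 0 < y) (hξ : 0 < ξ) :
    0 < kernelArg x y ξ := by
  unfold kernelArg
  positivity

/-- The argument of `D_{1-2a}` is `z = (2X)^{1/2}` with `X` the `kernelArg`, so `z²/2 = X`. The
exponential in the kernel contributes `e^{-X/2}` and the Whittaker function another `e^{-X/2}`; all
powers of 2 combine to `1/2`. -/
theorem kernelQ_eq {a x y ξ : ℝ} (ha : 0 ≤ a) (hx : 0 < x) (hy : 0 < y) (hξ : 0 < ξ) :
    kernelQ a x y ξ = (x * y * ξ) ^ a * Real.exp (x + y + ξ - kernelArg x y ξ) *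
      kernelArg x y ξ ^ (1 / 2 : ℝ) * tricomi a (kernelArg x y ξ) / (2 * √Real.pi) := by
  have hX := kernelArg_pos hx hy hξ
  set X := kernelArg x y ξ with hXdef
  have hz : (x * y + x * ξ + y * ξ) / (2 * x * y * ξ) ^ (1 / 2 : ℝ) = (2 * X) ^ (1 / 2 : ℝ) := by
    rw [show 2 * X = (x * y + x * ξ + y * ξ) ^ 2 / (2 * x * y * ξ) by
      rw [hXdef, kernelArg]; field_simp; norm_num]
    rw [← Real.sqrt_eq_rpow, ← Real.sqrt_eq_rpow, Real.sqrt_div (by positivity),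
      Real.sqrt_sq (by positivity)]
  have hz2 : ((2 * X) ^ (1 / 2 : ℝ)) ^ 2 / 2 = X := by
    rw [← Real.sqrt_eq_rpow, Real.sq_sqrt (by positivity)]
    ring
  unfold kernelQ parabolicD
  rw [hz, hz2, show (1 - 2 * a) / 2 + 1 / 4 = 3 / 4 - a by ring, whittakerW_eq ha]
  simp only [if_pos hX]
  have e1 : (x * y + x * ξ + y * ξ) ^ 2 / (8 * x * y * ξ) = X / 2 := by
    rw [hXdef, kernelArg]
    field_simp
    norm_num
  have e2 : Real.exp (x + y + ξ - X) = Real.exp (x + y + ξ - X / 2) * Real.exp (-X / 2) := by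
    rw [← Real.exp_add]
    ring_nf
  have e3 : Real.pi ^ (-(1 / 2) : ℝ) = (√Real.pi)⁻¹ := by
    rw [Real.rpow_neg Real.pi_pos.le, Real.sqrt_eq_rpow]
  have e4 : ((2 * X) ^ (1 / 2 : ℝ)) ^ (-(1 / 2) : ℝ) =
      2 ^ (-(1 / 4) : ℝ) * X ^ (-(1 / 4) : ℝ) := by
    rw [← Real.rpow_mul (by positivity), Real.mul_rpow (by positivity) hX.le]
    norm_num
  have e5 : X ^ (1 / 2 : ℝ) = X ^ (-(1 / 4) : ℝ) * X ^ (3 / 4 : ℝ) := by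
    rw [← Real.rpow_add hX]
    norm_num
  have e6 : (2 : ℝ)⁻¹ = 2 ^ (-(3 / 2) + a) * 2 ^ (3 / 4 - a) * 2 ^ (-(1 / 4) : ℝ) := by
    rw [← Real.rpow_add two_pos, ← Real.rpow_add two_pos, ← Real.rpow_neg_one]
    congr 1
    ring
  rw [e1, e2, e3, e4, e5, div_eq_mul_inv _ (2 * √Real.pi), mul_inv, e6]
  ring

theorem kernelQ_pos {a x y ξ : ℝ} (ha : 0 ≤ a) (hx : 0 < x) (hy : 0 < y) (hξ : 0 < ξ) :
    0 < kernelQ a x y ξ := by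
  have h1 := kernelArg_pos hx hy hξ
  have h2 := tricomi_pos ha h1
  have h3 := Real.pi_pos
  rw [kernelQ_eq ha hx hy hξ]
  positivity

/-! ### Evaluation of the normalizing integral -/

theorem lintegral_image_affine {s : Set ℝ} (hs : MeasurableSet s) {k : ℝ} (hk : 0 < k) (c : ℝ)
    (g : ℝ → ℝ≥0∞) :
    ∫⁻ x in (fun t => c + k * t) '' s, g x = ∫⁻ t in s, ENNReal.ofReal k * g (c + k * t) := by
  have h := lintegral_image_eq_lintegral_abs_deriv_mul (f := fun t => c + k * t)
    (f' := fun _ => k) hs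
    (fun x _ => ((((hasDerivAt_id x).const_mul k).const_add c).congr_deriv
      (mul_one k)).hasDerivWithinAt)
    (fun u _ v _ huv => by simpa [hk.ne'] using huv) g
  rwa [abs_of_pos hk] at h

theorem image_affine_Ioi {k : ℝ} (hk : 0 < k) (c : ℝ) :
    (fun t => c + k * t) '' Ioi 0 = Ioi c := by
  ext v
  refine ⟨?_, fun hv => ⟨(v - c) / k, div_pos (sub_pos.2 hv) hk, ?_⟩⟩
  · rintro ⟨t, ht, rfl⟩
    have : 0 < k * t := mul_pos hk ht
    simpa using this
  · field_simp
    ring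

theorem image_affine_Ioo {k : ℝ} (hk : 0 < k) (c : ℝ) :
    (fun t => c + k * t) '' Ioo 0 1 = Ioo c (c + k) := by
  ext v
  refine ⟨?_, fun hv => ⟨(v - c) / k, ⟨div_pos (sub_pos.2 hv.1) hk, ?_⟩, ?_⟩⟩
  · rintro ⟨t, ht, rfl⟩
    have h1 : 0 < k * t := mul_pos hk ht.1
    have h2 : k * t < k := by nlinarith [ht.2]
    exact ⟨by simpa using h1, by simpa using h2⟩
  · rw [div_lt_one hk]
    linarith [hv.2]
  · field_simp
    ring

theorem lintegral_exp_neg_sq : ∫⁻ w : ℝ, ENNReal.ofReal (Real.exp (-w ^ 2)) =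
    ENNReal.ofReal √Real.pi := by
  have h := integral_gaussian 1
  have hi := integrable_exp_neg_mul_sq (b := 1) one_pos
  rw [div_one] at h
  rw [← h, ofReal_integral_eq_lintegral_ofReal hi (ae_of_all _ fun w => by positivity)]
  simp

theorem lintegral_rpow_mul_exp_Ioi {s σ : ℝ} (hs : 0 < s) :
    ∫⁻ v in Ioi σ, ENNReal.ofReal (Real.exp (-v) * (v - σ) ^ (s - 1)) =
      ENNReal.ofReal (Real.exp (-σ) * Real.Gamma s) := by
  have h := lintegral_image_affine (s := Ioi 0) measurableSet_Ioi one_pos σ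
    (fun v => ENNReal.ofReal (Real.exp (-v) * (v - σ) ^ (s - 1)))
  rw [image_affine_Ioi one_pos] at h
  rw [h, Real.Gamma_eq_integral hs, ← integral_const_mul, ofReal_integral_eq_lintegral_ofReal]
  · refine setLIntegral_congr_fun measurableSet_Ioi fun t ht => ?_
    simp only [ENNReal.ofReal_one, one_mul]
    rw [neg_add, Real.exp_add, add_sub_cancel_left, mul_assoc]
  · exact (Real.GammaIntegral_convergent hs).const_mul _
  · refine (ae_restrict_mem measurableSet_Ioi).mono fun t ht => ?_
    have ht' : (0 : ℝ) < t := ht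
    positivity

theorem lintegral_beta {a : ℝ} (ha : 0 < a) :
    ∫⁻ u in Ioo (0 : ℝ) 1, ENNReal.ofReal ((u * (1 - u)) ^ (a - 1)) =
      ENNReal.ofReal (ProbabilityTheory.beta a a) := by
  have h := ProbabilityTheory.lintegral_betaPDF_eq_one ha ha
  have hb := ProbabilityTheory.beta_pos ha ha
  rw [ProbabilityTheory.lintegral_betaPDF] at h
  have : ∫⁻ u in Ioo (0 : ℝ) 1, ENNReal.ofReal ((u * (1 - u)) ^ (a - 1)) =
      ∫⁻ u in Ioo (0 : ℝ) 1, ENNReal.ofReal (ProbabilityTheory.beta a a) *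
        ENNReal.ofReal (1 / ProbabilityTheory.beta a a * u ^ (a - 1) * (1 - u) ^ (a - 1)) := by
    refine setLIntegral_congr_fun measurableSet_Ioo fun u hu => ?_
    have h1 : 0 < 1 - u := sub_pos.2 hu.2
    rw [← ENNReal.ofReal_mul hb.le, Real.mul_rpow hu.1.le h1.le]
    congr 1
    field_simp
  rw [this, lintegral_const_mul' _ _ ENNReal.ofReal_ne_top, h, mul_one]

/-- Substitute `v = X(1 + t)`. Now `X` enters only through `(v - X)^{a-1}` and the lower limit,
which prepares the exchange of integrals in `lintegral_core_of_pos`. -/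
theorem kummerInt_eq_lintegral {a X : ℝ} (ha : 0 < a) (hX : 0 < X) :
    ENNReal.ofReal (Real.exp (-X) * X ^ (1 / 2 : ℝ) * kummerInt a a X) =
      ∫⁻ v in Ioi X, ENNReal.ofReal (Real.exp (-v) * v ^ (1 / 2 - a) * (v - X) ^ (a - 1)) := by
  have h := lintegral_image_affine (s := Ioi 0) measurableSet_Ioi hX X
    (fun v => ENNReal.ofReal (Real.exp (-v) * v ^ (1 / 2 - a) * (v - X) ^ (a - 1)))
  rw [image_affine_Ioi hX] at h
  rw [h, kummerInt, ← integral_const_mul, ofReal_integral_eq_lintegral_ofReal]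
  · refine setLIntegral_congr_fun measurableSet_Ioi fun t ht => ?_
    have ht' : (0 : ℝ) < t := ht
    rw [← ENNReal.ofReal_mul hX.le, neg_add, Real.exp_add, add_sub_cancel_left,
      Real.mul_rpow hX.le ht'.le, show X + X * t = X * (1 + t) by ring,
      Real.mul_rpow hX.le (by positivity), Real.rpow_sub_one hX.ne', Real.rpow_sub hX]
    congr 1
    field_simp
  · exact (integrableOn_kummer ha.le ha hX).const_mul _
  · refine (ae_restrict_mem measurableSet_Ioi).mono fun t ht => ?_
    have ht' : (0 : ℝ) < t := ht
    positivity

/-- The beta integral between the two roots in `ρ` of `v = σ (1 + ρ)² / (4ρ)`. -/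
theorem lintegral_between_roots {a σ v : ℝ} (ha : 0 < a) (hσ : 0 < σ) (hv : σ < v) :
    ∫⁻ ρ in Ioi (0 : ℝ) ∩ {ρ | σ * (1 + ρ) ^ 2 / (4 * ρ) < v},
        ENNReal.ofReal (ρ ^ (a - 1) * (v - σ * (1 + ρ) ^ 2 / (4 * ρ)) ^ (a - 1)) =
      ENNReal.ofReal (4 ^ a * σ ^ (-a) * (v * (v - σ)) ^ (a - 1 / 2) *
        ProbabilityTheory.beta a a) := by
  have hv0 : 0 < v := hσ.trans hv
  have hvσ : 0 < v - σ := sub_pos.2 hv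
  -- The equation `v = σ(1 + ρ)²/(4ρ)` reads `ρ² - 2mρ + 1 = 0`; its roots are `m ± R` with `R² = m²
  -- - 1`.
  set m := 2 * v / σ - 1 with hm
  have hR0 : 0 < 4 * (v * (v - σ)) / σ ^ 2 := by positivity
  set R := √(4 * (v * (v - σ)) / σ ^ 2) with hR
  have hRpos : 0 < R := Real.sqrt_pos.2 hR0
  have hR2 : R ^ 2 = 4 * (v * (v - σ)) / σ ^ 2 := Real.sq_sqrt hR0.le
  have hmR : R ^ 2 = m ^ 2 - 1 := by
    rw [hR2, hm]
    field_simp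
    ring
  have hm1 : 1 < m := by
    rw [hm, lt_sub_iff_add_lt, lt_div_iff₀ hσ]
    linarith
  have hRm : R < m := by nlinarith
  have hfac : ∀ ρ, 0 < ρ → ρ * (v - σ * (1 + ρ) ^ 2 / (4 * ρ)) =
      σ / 4 * (R ^ 2 - (ρ - m) ^ 2) := by
    intro ρ hρ
    rw [hmR, hm]
    field_simp
    ring
  have hset : Ioi (0 : ℝ) ∩ {ρ | σ * (1 + ρ) ^ 2 / (4 * ρ) < v} =
      Ioo (m - R) (m - R + 2 * R) := by
    ext ρ
    constructor
    · rintro ⟨h0, h1⟩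
      have h0' : (0 : ℝ) < ρ := h0
      have h2 := hfac ρ h0' ▸ mul_pos h0' (sub_pos.2 h1)
      have h3 : (ρ - m) ^ 2 < R ^ 2 := by
        have := (pos_iff_pos_of_mul_pos h2).1 (by positivity)
        linarith
      have h4 := abs_lt_of_sq_lt_sq' h3 hRpos.le
      exact ⟨by linarith [h4.1], by linarith [h4.2]⟩
    · rintro ⟨h0, h1⟩
      have hρ : 0 < ρ := by linarith
      refine ⟨hρ, ?_⟩
      have h3 : 0 < σ / 4 * (R ^ 2 - (ρ - m) ^ 2) := by
        have : 0 < (R - (ρ - m)) * (R + (ρ - m)) := mul_pos (by linarith) (by linarith)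
        have h5 : 0 < R ^ 2 - (ρ - m) ^ 2 := by nlinarith
        positivity
      rw [← hfac ρ hρ] at h3
      exact sub_pos.1 ((pos_iff_pos_of_mul_pos h3).1 hρ)
  -- The substitution `ρ = m - R + 2Ru` turns `R² - (ρ - m)²` into `4R² u(1 - u)`, the beta
  -- integrand.
  rw [hset, ← image_affine_Ioo (by positivity : 0 < 2 * R),
    lintegral_image_affine measurableSet_Ioo (by positivity)]
  have hb := ProbabilityTheory.beta_pos ha ha
  have hconst : 4 ^ a * σ ^ (-a) * (v * (v - σ)) ^ (a - 1 / 2) = 2 * R * (σ * R ^ 2) ^ (a - 1) := by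
    have hw : 0 < v * (v - σ) := by positivity
    set w := v * (v - σ)
    rw [hR2, hR, show σ * (4 * w / σ ^ 2) = 4 * w / σ by field_simp, Real.sqrt_div (by positivity),
      Real.sqrt_sq hσ.le, Real.sqrt_mul (by norm_num), show √(4 : ℝ) = 2 by
        rw [show (4 : ℝ) = 2 ^ 2 by norm_num, Real.sqrt_sq two_pos.le],
      Real.div_rpow (by positivity) hσ.le, Real.rpow_sub_one hσ.ne', Real.rpow_neg hσ.le,
      Real.rpow_sub_one (by positivity), Real.mul_rpow (by norm_num) hw.le,
      Real.rpow_sub hw, ← Real.sqrt_eq_rpow]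
    have : √w ^ 2 = w := Real.sq_sqrt hw.le
    have hsw : 0 < √w := Real.sqrt_pos.2 hw
    field_simp
    rw [this]
    ring
  rw [hconst, ENNReal.ofReal_mul (by positivity : 0 ≤ 2 * R * (σ * R ^ 2) ^ (a - 1)),
    ← lintegral_beta ha,
    ← lintegral_const_mul' _ _ ENNReal.ofReal_ne_top]
  refine setLIntegral_congr_fun measurableSet_Ioo fun u hu => ?_
  have h1 : 0 < 1 - u := sub_pos.2 hu.2
  have h0 := hu.1
  have hρ : 0 < m - R + 2 * R * u := by nlinarith
  have hfac' : (m - R + 2 * R * u) * (v - σ * (1 + (m - R + 2 * R * u)) ^ 2 /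
      (4 * (m - R + 2 * R * u))) = σ * R ^ 2 * (u * (1 - u)) := by
    rw [hfac _ hρ]
    ring
  have hpos : 0 < v - σ * (1 + (m - R + 2 * R * u)) ^ 2 / (4 * (m - R + 2 * R * u)) :=
    (pos_iff_pos_of_mul_pos (hfac' ▸ (by positivity))).1 hρ
  rw [← ENNReal.ofReal_mul (by positivity), ← ENNReal.ofReal_mul (by positivity),
    ← Real.mul_rpow hρ.le hpos.le, hfac', Real.mul_rpow (by positivity) (by positivity)]
  congr 1
  ring

/-- Legendre's duplication formula, in the form that makes the constant of the normalizing integral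
independent of `a`. -/
theorem four_rpow_mul_beta {a : ℝ} (ha : 0 < a) :
    4 ^ a * ProbabilityTheory.beta a a * Real.Gamma (a + 1 / 2) / Real.Gamma a = 2 * √Real.pi := by
  have h := Real.Gamma_mul_Gamma_add_half a
  have h1 := Real.Gamma_pos_of_pos ha
  have h2 := Real.Gamma_pos_of_pos (show 0 < a + a by linarith)
  rw [← two_mul] at h2
  have h4 : (4 : ℝ) ^ a = 2 ^ (2 * a) := by
    rw [Real.rpow_mul two_pos.le]
    norm_num
  rw [ProbabilityTheory.beta, ← two_mul]
  calc 4 ^ a * (Real.Gamma a * Real.Gamma a / Real.Gamma (2 * a)) * Real.Gamma (a + 1 / 2) /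
        Real.Gamma a = 4 ^ a * (Real.Gamma a * Real.Gamma (a + 1 / 2)) / Real.Gamma (2 * a) := by
        field_simp
    _ = 4 ^ a * 2 ^ (1 - 2 * a) * √Real.pi := by
        rw [h]
        field_simp
    _ = 2 * √Real.pi := by
        rw [h4, ← Real.rpow_add two_pos]
        norm_num

/-- Write `U` as an integral over `v > A(ρ)` and integrate in `ρ` first. The beta integral between
the two roots produces `(v(v - σ))^{a-1/2}`; its factor `v^{a-1/2}` cancels `v^{1/2-a}`, and a gamma
integral of order `a + 1/2` over `v > σ` remains. -/
theorem lintegral_core_of_pos {a σ : ℝ} (ha : 0 < a) (hσ : 0 < σ) :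
    ∫⁻ ρ in Ioi (0 : ℝ), ENNReal.ofReal (ρ ^ (a - 1) * (Real.exp (-(σ * (1 + ρ) ^ 2 / (4 * ρ))) *
        (σ * (1 + ρ) ^ 2 / (4 * ρ)) ^ (1 / 2 : ℝ) * tricomi a (σ * (1 + ρ) ^ 2 / (4 * ρ)))) =
      ENNReal.ofReal (2 * √Real.pi * σ ^ (-a) * Real.exp (-σ)) := by
  have hG := Real.Gamma_pos_of_pos ha
  set A : ℝ → ℝ := fun ρ => σ * (1 + ρ) ^ 2 / (4 * ρ) with hA
  have hAm : Measurable A := by fun_prop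
  set F : ℝ → ℝ → ℝ≥0∞ := fun ρ v => ENNReal.ofReal (Real.exp (-v) * v ^ (1 / 2 - a)) *
    ({p : ℝ × ℝ | A p.1 < p.2}.indicator
      (fun p => ENNReal.ofReal (p.1 ^ (a - 1) * (p.2 - A p.1) ^ (a - 1))) (ρ, v)) with hF
  have hFm : Measurable (Function.uncurry F) := by
    refine Measurable.mul (by fun_prop) (Measurable.indicator (by fun_prop) ?_)
    exact measurableSet_lt (by fun_prop) (by fun_prop)
  have step1 : ∀ ρ ∈ Ioi (0 : ℝ), ENNReal.ofReal (ρ ^ (a - 1) * (Real.exp (-(A ρ)) *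
      (A ρ) ^ (1 / 2 : ℝ) * tricomi a (A ρ))) =
      ENNReal.ofReal (1 / Real.Gamma a) * ∫⁻ v in Ioi (0 : ℝ), F ρ v := by
    intro ρ hρ
    have hρ' : (0 : ℝ) < ρ := hρ
    have hA0 : 0 < A ρ := by positivity
    have e1 : ∫⁻ v in Ioi (0 : ℝ), F ρ v = ∫⁻ v in Ioi (0 : ℝ), (Ioi (A ρ)).indicator
        (fun v => ENNReal.ofReal (ρ ^ (a - 1)) *
          ENNReal.ofReal (Real.exp (-v) * v ^ (1 / 2 - a) * (v - A ρ) ^ (a - 1))) v := by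
      refine setLIntegral_congr_fun measurableSet_Ioi fun v hv => ?_
      have hv' : (0 : ℝ) < v := hv
      by_cases h : A ρ < v
      · have : 0 < v - A ρ := sub_pos.2 h
        simp only [hF, indicator, mem_ofPred_eq, mem_Ioi, if_pos h]
        rw [← ENNReal.ofReal_mul (by positivity), ← ENNReal.ofReal_mul (by positivity)]
        congr 1
        ring
      · simp only [hF, indicator, mem_ofPred_eq, mem_Ioi, if_neg h, mul_zero]
    rw [e1, setLIntegral_indicator measurableSet_Ioi,
      inter_eq_left.2 (Ioi_subset_Ioi hA0.le), lintegral_const_mul' _ _ ENNReal.ofReal_ne_top,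
      ← kummerInt_eq_lintegral ha hA0, tricomi_of_pos ha, ← ENNReal.ofReal_mul (by positivity),
      ← ENNReal.ofReal_mul (by positivity)]
    congr 1
    field_simp
  rw [setLIntegral_congr_fun measurableSet_Ioi step1,
    lintegral_const_mul' _ _ ENNReal.ofReal_ne_top,
    lintegral_lintegral_swap hFm.aemeasurable]
  have step2 : ∀ v ∈ Ioi (0 : ℝ), ∫⁻ ρ in Ioi (0 : ℝ), F ρ v = (Ioi σ).indicator
      (fun v => ENNReal.ofReal (4 ^ a * σ ^ (-a) * ProbabilityTheory.beta a a) *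
        ENNReal.ofReal (Real.exp (-v) * (v - σ) ^ (a + 1 / 2 - 1))) v := by
    intro v hv
    have hv' : (0 : ℝ) < v := hv
    have hb := ProbabilityTheory.beta_pos ha ha
    have e1 : ∫⁻ ρ in Ioi (0 : ℝ), F ρ v = ENNReal.ofReal (Real.exp (-v) * v ^ (1 / 2 - a)) *
        ∫⁻ ρ in Ioi (0 : ℝ) ∩ {ρ | A ρ < v},
          ENNReal.ofReal (ρ ^ (a - 1) * (v - A ρ) ^ (a - 1)) := by
      rw [inter_comm, ← setLIntegral_indicator (measurableSet_lt hAm measurable_const),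
        ← lintegral_const_mul' _ _ ENNReal.ofReal_ne_top]
      rfl
    rw [e1]
    by_cases h : σ < v
    · have hvσ : 0 < v - σ := sub_pos.2 h
      rw [indicator_of_mem (mem_Ioi.2 h), lintegral_between_roots ha hσ h,
        ← ENNReal.ofReal_mul (by positivity), ← ENNReal.ofReal_mul (by positivity),
        Real.mul_rpow hv'.le hvσ.le, show a + 1 / 2 - 1 = a - 1 / 2 by ring,
        show 1 / 2 - a = -(a - 1 / 2) by ring, Real.rpow_neg hv'.le]
      congr 1
      field_simp
    · rw [indicator_of_notMem (by simpa using h)]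
      -- By `(1 + ρ)² ≥ 4ρ` the minimum of `A` is `σ`, so nothing lies below `v ≤ σ`.
      have : Ioi (0 : ℝ) ∩ {ρ | A ρ < v} = ∅ := by
        refine eq_empty_of_forall_notMem ?_
        rintro ρ ⟨h0, h1⟩
        have h0' : (0 : ℝ) < ρ := h0
        refine h (lt_of_le_of_lt ?_ h1)
        simp only [hA]
        rw [le_div_iff₀ (by positivity)]
        nlinarith [mul_nonneg hσ.le (sq_nonneg (1 - ρ))]
      rw [this, Measure.restrict_empty, lintegral_zero_measure, mul_zero]
  rw [setLIntegral_congr_fun measurableSet_Ioi step2, setLIntegral_indicator measurableSet_Ioi,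
    inter_eq_left.2 (Ioi_subset_Ioi hσ.le), lintegral_const_mul' _ _ ENNReal.ofReal_ne_top,
    lintegral_rpow_mul_exp_Ioi (by linarith), ← four_rpow_mul_beta ha]
  have hb := ProbabilityTheory.beta_pos ha ha
  rw [← ENNReal.ofReal_mul (by positivity), ← ENNReal.ofReal_mul (by positivity)]
  congr 1
  field_simp

/-- For `a = 0` the beta integral diverges, but `U = 1`. With `w = (√σ/2)(√ρ - 1/√ρ)` the exponent
is `σ + w²` and the remaining factor is `2 dw/dρ`, so the integral is Gaussian over the whole line.
-/
theorem lintegral_core_zero {σ : ℝ} (hσ : 0 < σ) :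
    ∫⁻ ρ in Ioi (0 : ℝ), ENNReal.ofReal (ρ ^ (-1 : ℝ) * (Real.exp (-(σ * (1 + ρ) ^ 2 / (4 * ρ))) *
        (σ * (1 + ρ) ^ 2 / (4 * ρ)) ^ (1 / 2 : ℝ))) =
      ENNReal.ofReal (2 * √Real.pi * Real.exp (-σ)) := by
  set s := √σ with hs
  have hs0 : 0 < s := Real.sqrt_pos.2 hσ
  have hs2 : s ^ 2 = σ := Real.sq_sqrt hσ.le
  set f : ℝ → ℝ := fun ρ => s / 2 * (√ρ - (√ρ)⁻¹) with hf
  set f' : ℝ → ℝ := fun ρ => s / 4 * ((√ρ)⁻¹ + (√ρ)⁻¹ / ρ) with hf'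
  have hder : ∀ ρ ∈ Ioi (0 : ℝ), HasDerivWithinAt f (f' ρ) (Ioi 0) ρ := by
    intro ρ hρ
    have hρ' : (0 : ℝ) < ρ := hρ
    have hr : 0 < √ρ := Real.sqrt_pos.2 hρ'
    have h1 := Real.hasDerivAt_sqrt hρ'.ne'
    refine (((h1.sub (h1.inv hr.ne')).const_mul (s / 2)).congr_deriv ?_).hasDerivWithinAt
    rw [hf']
    simp only
    rw [Real.sq_sqrt hρ'.le]
    field_simp
    ring
  have hmono : StrictMonoOn f (Ioi 0) := by
    intro p hp q hq hpq
    have hp' : (0 : ℝ) < √p := Real.sqrt_pos.2 hp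
    have h1 : √p < √q := Real.sqrt_lt_sqrt (le_of_lt hp) hpq
    have h2 : (√q)⁻¹ < (√p)⁻¹ := inv_strictAnti₀ hp' h1
    simp only [hf]
    exact mul_lt_mul_of_pos_left (by linarith) (by positivity)
  have himg : f '' Ioi 0 = univ := by
    refine eq_univ_of_forall fun w => ?_
    set b := w / s with hb
    have hq : 0 < √(b ^ 2 + 1) := Real.sqrt_pos.2 (by positivity)
    have hq2 : √(b ^ 2 + 1) ^ 2 = b ^ 2 + 1 := Real.sq_sqrt (by positivity)
    have hr : 0 < b + √(b ^ 2 + 1) := by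
      have : |b| < √(b ^ 2 + 1) := by
        rw [← Real.sqrt_sq_eq_abs]
        exact Real.sqrt_lt_sqrt (sq_nonneg b) (by linarith)
      linarith [neg_abs_le b]
    -- The positive solution `r = √ρ` of `r - 1/r = 2b`.
    refine ⟨(b + √(b ^ 2 + 1)) ^ 2, mem_Ioi.2 (by positivity), ?_⟩
    simp only [hf]
    rw [Real.sqrt_sq hr.le]
    have hinv : (b + √(b ^ 2 + 1))⁻¹ = √(b ^ 2 + 1) - b := by
      exact inv_eq_of_mul_eq_one_left (by nlinarith)
    rw [hinv, hb]
    field_simp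
    ring
  have h := lintegral_image_eq_lintegral_abs_deriv_mul measurableSet_Ioi hder hmono.injOn
    (fun w => ENNReal.ofReal (Real.exp (-w ^ 2)))
  rw [himg, Measure.restrict_univ, lintegral_exp_neg_sq] at h
  rw [show 2 * √Real.pi * Real.exp (-σ) = 2 * Real.exp (-σ) * √Real.pi by ring,
    ENNReal.ofReal_mul (by positivity), h, ← lintegral_const_mul' _ _ ENNReal.ofReal_ne_top]
  refine setLIntegral_congr_fun measurableSet_Ioi fun ρ hρ => ?_
  have hρ' : (0 : ℝ) < ρ := hρ
  obtain ⟨r, hr, rfl⟩ : ∃ r : ℝ, 0 < r ∧ r ^ 2 = ρ :=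
    ⟨√ρ, Real.sqrt_pos.2 hρ', Real.sq_sqrt hρ'.le⟩
  have e1 : σ * (1 + r ^ 2) ^ 2 / (4 * r ^ 2) = (s * (1 + r ^ 2) / (2 * r)) ^ 2 := by
    rw [← hs2]
    field_simp
    norm_num
  have e2 : (s * (1 + r ^ 2) / (2 * r)) ^ 2 = σ + (s / 2 * (r - r⁻¹)) ^ 2 := by
    rw [← hs2]
    field_simp
    ring
  simp only [hf, hf']
  rw [e1, ← Real.sqrt_eq_rpow, Real.sqrt_sq (by positivity), Real.sqrt_sq hr.le,
    abs_of_pos (by positivity), ← ENNReal.ofReal_mul (by positivity),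
    ← ENNReal.ofReal_mul (by positivity), e2, neg_add, Real.exp_add, Real.rpow_neg_one]
  congr 1
  field_simp
  ring

theorem lintegral_core {a σ : ℝ} (ha : 0 ≤ a) (hσ : 0 < σ) :
    ∫⁻ ρ in Ioi (0 : ℝ), ENNReal.ofReal (ρ ^ (a - 1) * (Real.exp (-(σ * (1 + ρ) ^ 2 / (4 * ρ))) *
        (σ * (1 + ρ) ^ 2 / (4 * ρ)) ^ (1 / 2 : ℝ) * tricomi a (σ * (1 + ρ) ^ 2 / (4 * ρ)))) =
      ENNReal.ofReal (2 * √Real.pi * σ ^ (-a) * Real.exp (-σ)) := by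
  rcases ha.eq_or_lt with rfl | ha
  · simpa [tricomi_zero] using lintegral_core_zero hσ
  · exact lintegral_core_of_pos ha hσ

/-! ### Measurability, the weight, and total mass 1 -/

theorem measurable_whittakerW {a : ℝ} (ha : 0 ≤ a) :
    Measurable (whittakerW (3 / 4 - a) (1 / 4)) := by
  have h := isWhittakerW_whittakerW ha
  obtain ⟨u', hu'⟩ := h.ode
  have hc : ContinuousOn (whittakerW (3 / 4 - a) (1 / 4)) (Ioi 0) := fun x hx =>
    (hu' x hx).1.continuousAt.continuousWithinAt
  have e : whittakerW (3 / 4 - a) (1 / 4) =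
      (Ioi 0).piecewise (whittakerW (3 / 4 - a) (1 / 4)) (fun _ => 0) := by
    funext x
    by_cases hx : 0 < x
    · rw [piecewise_eq_of_mem _ _ _ (mem_Ioi.2 hx)]
    · rw [piecewise_eq_of_notMem _ _ _ (by simpa using hx), h.eq_zero x (not_lt.1 hx)]
  rw [e]
  exact hc.measurable_piecewise continuousOn_const measurableSet_Ioi

theorem measurable_kernelQ {a : ℝ} (ha : 0 ≤ a) {α : Type*} [MeasurableSpace α] {x y ξ : α → ℝ}
    (hx : Measurable x) (hy : Measurable y) (hξ : Measurable ξ) :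
    Measurable fun t => kernelQ a (x t) (y t) (ξ t) := by
  have hW := measurable_whittakerW ha
  unfold kernelQ parabolicD
  rw [show (1 - 2 * a) / 2 + 1 / 4 = 3 / 4 - a by ring]
  fun_prop

theorem measurable_weightM (a : ℝ) : Measurable (weightM a) := by
  unfold weightM
  fun_prop

theorem weightM_pos (a : ℝ) {ξ : ℝ} (hξ : 0 < ξ) : 0 < weightM a ξ := by
  unfold weightM
  positivity

theorem lintegral_measureM (a : ℝ) (f : ℝ → ℝ≥0∞) :
    ∫⁻ ξ, f ξ ∂measureM a = ∫⁻ ξ in Ioi (0 : ℝ), ENNReal.ofReal (weightM a ξ) * f ξ := by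
  unfold measureM
  rw [lintegral_withDensity_eq_lintegral_mul_non_measurable _
    (measurable_weightM a).ennreal_ofReal (ae_of_all _ fun _ => ENNReal.ofReal_lt_top)]
  rfl

/-- The kernel is a probability density with respect to the weight. -/
theorem lintegral_kernelQ {a x y : ℝ} (ha : 0 ≤ a) (hx : 0 < x) (hy : 0 < y) :
    ∫⁻ ξ, ENNReal.ofReal (kernelQ a x y ξ) ∂measureM a = 1 := by
  have hpi := Real.pi_pos
  -- Under `ξ = k/ρ` the `kernelArg` becomes `(x + y)(1 + ρ)²/(4ρ)`, the integrand of
  -- `lintegral_core` with `σ = x + y`.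
  set k := x * y / (x + y) with hk
  have hk0 : 0 < k := by positivity
  rw [lintegral_measureM]
  have himg : (fun ρ : ℝ => k / ρ) '' Ioi 0 = Ioi 0 := by
    ext v
    constructor
    · rintro ⟨ρ, hρ, rfl⟩
      exact div_pos hk0 hρ
    · intro hv
      have hv' : (0 : ℝ) < v := hv
      exact ⟨k / v, div_pos hk0 hv', by field_simp⟩
  have h := lintegral_image_eq_lintegral_abs_deriv_mul (f := fun ρ => k / ρ)
    (f' := fun ρ => -k / ρ ^ 2) measurableSet_Ioi
    (fun ρ hρ => (((hasDerivAt_const ρ k).div (hasDerivAt_id ρ)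
      (ne_of_gt hρ)).congr_deriv (by simp)).hasDerivWithinAt)
    (fun p hp q hq hpq => by
      have hp' : (0 : ℝ) < p := hp
      have hq' : (0 : ℝ) < q := hq
      simp only at hpq
      field_simp at hpq
      exact hpq.symm)
    (fun ξ => ENNReal.ofReal (weightM a ξ) * ENNReal.ofReal (kernelQ a x y ξ))
  rw [himg] at h
  have hcore := lintegral_core ha (add_pos hx hy)
  have hval : ENNReal.ofReal ((x + y) ^ a * Real.exp (x + y) / (2 * √Real.pi)) *
      ENNReal.ofReal (2 * √Real.pi * (x + y) ^ (-a) * Real.exp (-(x + y))) = 1 := by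
    rw [← ENNReal.ofReal_mul (by positivity), ← ENNReal.ofReal_one, Real.rpow_neg (by positivity),
      Real.exp_neg]
    congr 1
    field_simp
  rw [h, ← hval, ← hcore, ← lintegral_const_mul' _ _ ENNReal.ofReal_ne_top]
  refine setLIntegral_congr_fun measurableSet_Ioi fun ρ hρ => ?_
  have hρ' : (0 : ℝ) < ρ := hρ
  have hξ : 0 < k / ρ := by positivity
  have hX : kernelArg x y (k / ρ) = (x + y) * (1 + ρ) ^ 2 / (4 * ρ) := by
    rw [kernelArg, hk]
    field_simp
    ring
  have hX0 : 0 < (x + y) * (1 + ρ) ^ 2 / (4 * ρ) := by positivity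
  have ht := tricomi_pos ha hX0
  have hw := weightM_pos a hξ
  have hpow : ((x + y) * k * k / ρ) ^ a = (x + y) ^ a * k ^ a * k ^ a / ρ ^ a := by
    rw [Real.div_rpow (by positivity) hρ'.le, Real.mul_rpow (by positivity) hk0.le,
      Real.mul_rpow (by positivity) hk0.le]
  rw [← ENNReal.ofReal_mul hw.le, ← ENNReal.ofReal_mul (abs_nonneg _),
    ← ENNReal.ofReal_mul (by positivity), neg_div, abs_neg, abs_of_pos (by positivity),
    kernelQ_eq ha hx hy hξ, hX, weightM]
  congr 1
  rw [show x + y + k / ρ - (x + y) * (1 + ρ) ^ 2 / (4 * ρ) =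
      (x + y) + k / ρ + -((x + y) * (1 + ρ) ^ 2 / (4 * ρ)) by ring, Real.exp_add, Real.exp_add,
    Real.exp_neg (k / ρ), show x * y = (x + y) * k by rw [hk]; field_simp,
    show (x + y) * k * (k / ρ) = (x + y) * k * k / ρ by ring,
    hpow, Real.div_rpow hk0.le hρ'.le, Real.rpow_sub_one hk0.ne',
    Real.rpow_sub_one hρ'.ne', Real.rpow_sub_one hρ'.ne', show -2 * a = -a + -a by ring,
    Real.rpow_add hk0, Real.rpow_add hρ', Real.rpow_neg hk0.le, Real.rpow_neg hρ'.le]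
  generalize (x + y) * (1 + ρ) ^ 2 / (4 * ρ) = X
  field_simp

/-! ### Symmetry, continuity and bounds of the kernel -/

theorem kernelQ_swap_left (a x y ξ : ℝ) : kernelQ a x y ξ = kernelQ a y x ξ := by
  unfold kernelQ
  rw [mul_comm x y, add_comm x y, add_right_comm (y * x) (x * ξ) (y * ξ),
    show 8 * x * y * ξ = 8 * y * x * ξ by ring, show 2 * x * y * ξ = 2 * y * x * ξ by ring]

/-- Needed to integrate in `x` instead of `ξ`, and to move the domination bound from `ξ` to `x`. -/
theorem kernelQ_swap_outer (a x y ξ : ℝ) : kernelQ a x y ξ = kernelQ a ξ y x := by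
  unfold kernelQ
  rw [show x * y * ξ = ξ * y * x by ring, show x + y + ξ = ξ + y + x by ring,
    show x * y + x * ξ + y * ξ = ξ * y + ξ * x + y * x by ring,
    show 8 * x * y * ξ = 8 * ξ * y * x by ring, show 2 * x * y * ξ = 2 * ξ * y * x by ring]

theorem continuousAt_kernelQ {a x y ξ : ℝ} (ha : 0 ≤ a) (hx : 0 < x) (hy : 0 < y) (hξ : 0 < ξ) :
    ContinuousAt (fun x => kernelQ a x y ξ) x := by
  have e : (fun x => kernelQ a x y ξ) =ᶠ[𝓝 x] fun x => (x * y * ξ) ^ a *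
      Real.exp (x + y + ξ - kernelArg x y ξ) * kernelArg x y ξ ^ (1 / 2 : ℝ) *
      tricomi a (kernelArg x y ξ) / (2 * √Real.pi) := by
    filter_upwards [lt_mem_nhds hx] with t ht using kernelQ_eq ha ht hy hξ
  have hA : ContinuousAt (fun x => kernelArg x y ξ) x := by
    unfold kernelArg
    refine ContinuousAt.div (by fun_prop) (by fun_prop) (by positivity)
  have hT : ContinuousAt (fun x => tricomi a (kernelArg x y ξ)) x :=
    ContinuousAt.comp (g := tricomi a) (f := fun x => kernelArg x y ξ)
      ((continuousOn_tricomi ha).continuousAt (Ioi_mem_nhds (kernelArg_pos hx hy hξ))) hA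
  refine ContinuousAt.congr ?_ e.symm
  refine ContinuousAt.div_const (ContinuousAt.mul (ContinuousAt.mul (ContinuousAt.mul ?_ ?_) ?_)
    hT) _
  · exact ContinuousAt.rpow_const (by fun_prop) (Or.inr ha)
  · exact ContinuousAt.rexp (by fun_prop)
  · exact hA.rpow_const (Or.inr (by norm_num))

/-- The source of every decay estimate: the exponent `x + y + ξ - X` equals `(x + y + ξ)/2 - (xy/ξ +
xξ/y + yξ/x)/4`. -/
theorem two_mul_kernelArg {x y ξ : ℝ} (hx : 0 < x) (hy : 0 < y) (hξ : 0 < ξ) :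
    2 * kernelArg x y ξ = x + y + ξ + (x * y / ξ + x * ξ / y + y * ξ / x) / 2 := by
  unfold kernelArg
  field_simp
  ring

/-- By `tricomi_le`, `X^{1/2} U(a, 3/2, X) ≤ X^{-1/2-a}(X + a)`; the exponent `-1/2 - a` is negative
and `X ≥ y/2`. -/
theorem kernelQ_le {a x y ξ : ℝ} (ha : 0 ≤ a) (hx : 0 < x) (hy : 0 < y) (hξ : 0 < ξ) :
    kernelQ a x y ξ ≤ (y / 2) ^ (-(1 / 2) - a) * (x * y * ξ) ^ a *
      Real.exp (x + y + ξ - kernelArg x y ξ) * (kernelArg x y ξ + a) := by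
  have hX := kernelArg_pos hx hy hξ
  have h2X := two_mul_kernelArg hx hy hξ
  rw [kernelQ_eq ha hx hy hξ]
  generalize kernelArg x y ξ = X at *
  have hyX : y / 2 ≤ X := by
    have : 0 < (x * y / ξ + x * ξ / y + y * ξ / x) / 2 := by positivity
    linarith
  have hpi : 1 ≤ 2 * √Real.pi := by
    have : 1 ≤ √Real.pi := Real.one_le_sqrt.2 (by linarith [Real.pi_gt_three])
    linarith
  have h1 : X ^ (1 / 2 : ℝ) * tricomi a X ≤ (y / 2) ^ (-(1 / 2) - a) * (X + a) := by
    calc X ^ (1 / 2 : ℝ) * tricomi a X ≤ X ^ (1 / 2 : ℝ) * (X ^ (-a) * (1 + a / X)) := by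
          gcongr
          exact tricomi_le ha hX
      _ = X ^ (-(1 / 2) - a) * (X + a) := by
          rw [show (-(1 / 2) - a : ℝ) = 1 / 2 + -a - 1 by ring, Real.rpow_sub_one hX.ne',
            Real.rpow_add hX]
          field_simp
      _ ≤ _ := by
          gcongr ?_ * _
          exact Real.rpow_le_rpow_of_nonpos (by positivity) hyX (by linarith)
  have h0 := tricomi_pos ha hX
  calc (x * y * ξ) ^ a * Real.exp (x + y + ξ - X) * X ^ (1 / 2 : ℝ) * tricomi a X / (2 * √Real.pi)
      ≤ (x * y * ξ) ^ a * Real.exp (x + y + ξ - X) * X ^ (1 / 2 : ℝ) * tricomi a X :=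
        div_le_self (by positivity) hpi
    _ = (x * y * ξ) ^ a * Real.exp (x + y + ξ - X) * (X ^ (1 / 2 : ℝ) * tricomi a X) := by ring
    _ ≤ (x * y * ξ) ^ a * Real.exp (x + y + ξ - X) * ((y / 2) ^ (-(1 / 2) - a) * (X + a)) := by
        gcongr
    _ = _ := by ring

theorem exists_rpow_mul_exp_neg_le {N k : ℝ} (hN : 0 ≤ N) (hk : 0 < k) :
    ∃ C : ℝ, 0 < C ∧ ∀ s : ℝ, 0 < s → s ^ N * Real.exp (-(k * s)) ≤ C := by
  set n := ⌈N⌉₊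
  refine ⟨1 + n.factorial / k ^ n, by positivity, fun s hs => ?_⟩
  have h1 : s ^ N ≤ 1 + s ^ n := by
    rcases le_total s 1 with h | h
    · have := Real.rpow_le_one hs.le h hN
      have := pow_pos hs n
      linarith
    · have := Real.rpow_le_rpow_of_exponent_le h (Nat.le_ceil N)
      rw [Real.rpow_natCast] at this
      linarith
  have h2 : s ^ n ≤ n.factorial / k ^ n * Real.exp (k * s) := by
    have := Real.pow_div_factorial_le_exp (k * s) (by positivity) n
    rw [div_le_iff₀ (by positivity), mul_pow] at this
    rw [div_mul_eq_mul_div, le_div_iff₀ (by positivity)]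
    linarith
  have h3 : 1 ≤ Real.exp (k * s) := Real.one_le_exp (by positivity)
  rw [Real.exp_neg, ← div_eq_mul_inv, div_le_iff₀ (Real.exp_pos _)]
  nlinarith

/-- For two arguments in a compact subset of `(0, ∞)` the kernel is dominated by one function of
the third. -/
theorem exists_kernelQ_le {a M r : ℝ} (ha : 0 ≤ a) (hM : 0 < M) (hr : 1 ≤ r) :
    ∃ K : ℝ, 0 < K ∧ ∀ x ∈ Icc M⁻¹ M, ∀ y ∈ Icc M⁻¹ M, ∀ ξ : ℝ, 0 < ξ →
      kernelQ a x y ξ ≤ K * (ξ ^ (2 * a + 1) * Real.exp (ξ / (2 * r))) := by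
  -- From the term `xy/(4ξ) ≥ 1/(4M²ξ)` of the exponent.
  set k := (4 * M ^ 2)⁻¹ with hk
  have hk0 : 0 < k := by positivity
  obtain ⟨C₁, hC₁, h₁⟩ := exists_rpow_mul_exp_neg_le (N := a + 1) (by linarith) hk0
  obtain ⟨C₂, hC₂, h₂⟩ := exists_rpow_mul_exp_neg_le (N := a + 2) (by linarith) hk0
  have hB : 0 < (M⁻¹ / 2) ^ (-(1 / 2) - a) * (M * M) ^ a * Real.exp M := by positivity
  have hD : 0 < M + 1 + M ^ 2 + a := by positivity
  refine ⟨(M⁻¹ / 2) ^ (-(1 / 2) - a) * (M * M) ^ a * Real.exp M * (M + 1 + M ^ 2 + a) *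
    (C₁ + C₂) * (2 * r), by positivity, fun x hx y hy ξ hξ => ?_⟩
  have hx0 : 0 < x := (inv_pos.2 hM).trans_le hx.1
  have hy0 : 0 < y := (inv_pos.2 hM).trans_le hy.1
  have hxi : x⁻¹ ≤ M := inv_le_of_inv_le₀ hM hx.1
  have hyi : y⁻¹ ≤ M := inv_le_of_inv_le₀ hM hy.1
  have h2X := two_mul_kernelArg hx0 hy0 hξ
  have hX0 := kernelArg_pos hx0 hy0 hξ
  refine (kernelQ_le ha hx0 hy0 hξ).trans ?_
  generalize kernelArg x y ξ = X at *
  have b1 : (y / 2) ^ (-(1 / 2) - a) ≤ (M⁻¹ / 2) ^ (-(1 / 2) - a) :=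
    Real.rpow_le_rpow_of_nonpos (by positivity) (by linarith [hy.1]) (by linarith)
  have b2 : (x * y * ξ) ^ a ≤ (M * M) ^ a * ξ ^ a := by
    rw [← Real.mul_rpow (by positivity) hξ.le]
    gcongr
    · exact hx.2
    · exact hy.2
  have b3 : Real.exp (x + y + ξ - X) ≤ Real.exp M * Real.exp (-(k * ξ⁻¹)) := by
    rw [← Real.exp_add, Real.exp_le_exp]
    have h1 : k * ξ⁻¹ ≤ x * y / ξ / 4 := by
      have : M⁻¹ * M⁻¹ ≤ x * y := mul_le_mul hx.1 hy.1 (by positivity) hx0.le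
      have e : k * ξ⁻¹ = M⁻¹ * M⁻¹ / ξ / 4 := by
        rw [hk]
        field_simp
      rw [e]
      gcongr
    -- A quarter of the right side cancels the growth `ξ/2` of the exponent exactly, leaving only
    -- polynomial growth as `ξ → ∞`.
    have h2 : 2 * ξ ≤ x * ξ / y + y * ξ / x := by
      rw [div_add_div _ _ hy0.ne' hx0.ne', le_div_iff₀ (by positivity)]
      nlinarith [mul_nonneg hξ.le (sq_nonneg (x - y))]
    linarith [hx.2, hy.2]
  have b4 : X + a ≤ (M + 1 + M ^ 2 + a) * ((1 + ξ) * (1 + ξ⁻¹)) := by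
    have h1 : x * y / ξ ≤ M ^ 2 * ξ⁻¹ := by
      rw [div_eq_mul_inv, sq]
      gcongr
      · exact hx.2
      · exact hy.2
    have h2 : x * ξ / y ≤ M ^ 2 * ξ := by
      rw [show x * ξ / y = x * y⁻¹ * ξ by field_simp, sq]
      gcongr
      exact hx.2
    have h3 : y * ξ / x ≤ M ^ 2 * ξ := by
      rw [show y * ξ / x = y * x⁻¹ * ξ by field_simp, sq]
      gcongr
      exact hy.2
    have h4 : (1 + ξ) * (1 + ξ⁻¹) = 2 + ξ + ξ⁻¹ := by
      field_simp
      ring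
    rw [h4]
    have hi : 0 < ξ⁻¹ := by positivity
    have : 0 < M ^ 2 := by positivity
    nlinarith [hx.2, hy.2, mul_pos hM hξ, mul_pos hM hi, mul_nonneg ha hξ.le, mul_nonneg ha hi.le]
  -- The factor `e^{-k/ξ}` beats every negative power of `ξ`, so the power `ξ^{2a+1}` that
  -- compensates the weight can be extracted.
  have b5 : ξ ^ a * Real.exp (-(k * ξ⁻¹)) * (1 + ξ⁻¹) ≤ (C₁ + C₂) * ξ ^ (2 * a + 1) := by
    have e0 : ξ⁻¹ ^ (a + 1) = (ξ ^ (a + 1))⁻¹ := Real.inv_rpow hξ.le _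
    have e1 := h₁ ξ⁻¹ (inv_pos.2 hξ)
    have e2 := h₂ ξ⁻¹ (inv_pos.2 hξ)
    have e3 : ξ⁻¹ ^ (a + 2) = ξ⁻¹ ^ (a + 1) * ξ⁻¹ := by
      rw [← Real.rpow_add_one (by positivity)]
      ring_nf
    have e4 : ξ ^ (2 * a + 1) = ξ ^ a * ξ ^ (a + 1) := by
      rw [← Real.rpow_add hξ]
      ring_nf
    have hp : 0 < ξ ^ (a + 1) := by positivity
    calc ξ ^ a * Real.exp (-(k * ξ⁻¹)) * (1 + ξ⁻¹) = (ξ⁻¹ ^ (a + 1) * Real.exp (-(k * ξ⁻¹)) +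
          ξ⁻¹ ^ (a + 2) * Real.exp (-(k * ξ⁻¹))) * ξ ^ (2 * a + 1) := by
          rw [e3, e0, e4]
          field_simp
      _ ≤ _ := by gcongr
  -- The linear growth is relaxed to `e^{ξ/(2r)}`, whose `r`-th power is still integrable against
  -- `e^{-ξ}`.
  have b6 : 1 + ξ ≤ 2 * r * Real.exp (ξ / (2 * r)) := by
    have := Real.add_one_le_exp (ξ / (2 * r))
    calc 1 + ξ ≤ 2 * r * (ξ / (2 * r) + 1) := by
          field_simp
          linarith
      _ ≤ _ := by gcongr
  calc (y / 2) ^ (-(1 / 2) - a) * (x * y * ξ) ^ a * Real.exp (x + y + ξ - X) * (X + a)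
      ≤ (M⁻¹ / 2) ^ (-(1 / 2) - a) * ((M * M) ^ a * ξ ^ a) *
        (Real.exp M * Real.exp (-(k * ξ⁻¹))) * ((M + 1 + M ^ 2 + a) * ((1 + ξ) * (1 + ξ⁻¹))) := by
        gcongr
    _ = (M⁻¹ / 2) ^ (-(1 / 2) - a) * (M * M) ^ a * Real.exp M * (M + 1 + M ^ 2 + a) *
        (ξ ^ a * Real.exp (-(k * ξ⁻¹)) * (1 + ξ⁻¹)) * (1 + ξ) := by ring
    _ ≤ (M⁻¹ / 2) ^ (-(1 / 2) - a) * (M * M) ^ a * Real.exp M * (M + 1 + M ^ 2 + a) *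
        ((C₁ + C₂) * ξ ^ (2 * a + 1)) * (2 * r * Real.exp (ξ / (2 * r))) := by
        gcongr
    _ = _ := by ring

theorem weightM_mul_kernelQ_le {a x y ξ : ℝ} (ha : 0 ≤ a) (hx : 0 < x) (hy : 0 < y)
    (hξ : 0 < ξ) :
    weightM a ξ * kernelQ a x y ξ ≤ (y / 2) ^ (-(1 / 2) - a) * y ^ a * (x ^ a * ξ⁻¹ ^ (a + 1)) *
      Real.exp (x + y - kernelArg x y ξ) * (kernelArg x y ξ + a) := by
  refine (mul_le_mul_of_nonneg_left (kernelQ_le ha hx hy hξ)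
    (weightM_pos a hξ).le).trans (le_of_eq ?_)
  have hp : 0 < ξ ^ a := by positivity
  rw [weightM, show x + y + ξ - kernelArg x y ξ = ξ + (x + y - kernelArg x y ξ) by ring,
    Real.exp_add ξ, Real.exp_neg, Real.mul_rpow (by positivity) hξ.le, Real.mul_rpow hx.le hy.le,
    Real.inv_rpow hξ.le, Real.rpow_add_one hξ.ne', Real.rpow_sub_one hξ.ne',
    show -2 * a = -a + -a by ring, Real.rpow_add hξ, Real.rpow_neg hξ.le]
  field_simp

set_option maxHeartbeats 1000000 in
-- After the weight cancels `e^ξ`, the exponent is `y/2 - ξ/2 - x(ξ - y)²/(4yξ) - yξ/(4x)`. Away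
-- from `ξ = y` the quotient `(ξ - y)²/(yξ)` is at least a multiple of `S = ξ + 1/ξ`, so there is
-- decay in `xS`: half of it absorbs the powers, the other half decays in both `x` and `ξ`.
theorem exists_weightM_mul_kernelQ_le_atTop {a y δ : ℝ} (ha : 0 ≤ a) (hy : 0 < y) (hδ : 0 < δ) :
    ∃ C k : ℝ, 0 < C ∧ 0 < k ∧ ∀ x : ℝ, 1 ≤ x → ∀ ξ : ℝ, 0 < ξ → δ ≤ |ξ - y| →
      weightM a ξ * kernelQ a x y ξ ≤ C * Real.exp (-(k * x)) * Real.exp (-(k * ξ)) := by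
  -- Chosen so that `1 + ξ² ≤ L(ξ - y)²`: use `ξ² ≤ 2(ξ - y)² + 2y²` and `δ² ≤ (ξ - y)²`.
  obtain ⟨L, hL⟩ : ∃ L, L = 2 + (1 + 2 * y ^ 2) / δ ^ 2 := ⟨_, rfl⟩
  have hL0 : 0 < L := by
    rw [hL]
    positivity
  -- The exponent gains `xS/(4yL) = 2k · xS`, split into two equal parts.
  obtain ⟨k, hk⟩ : ∃ k, k = (8 * (y * L))⁻¹ := ⟨_, rfl⟩
  have hk0 : 0 < k := by
    rw [hk]
    positivity
  obtain ⟨C, hC, hs⟩ := exists_rpow_mul_exp_neg_le (N := a + 2) (by linarith) hk0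
  obtain ⟨D, hD⟩ : ∃ D, D = 3 / 2 * (1 + y + y⁻¹ + a) := ⟨_, rfl⟩
  have hD0 : 0 < D := by
    rw [hD]
    positivity
  obtain ⟨B, hB⟩ : ∃ B, B = (y / 2) ^ (-(1 / 2) - a) * y ^ a := ⟨_, rfl⟩
  have hB0 : 0 < B := by
    rw [hB]
    positivity
  refine ⟨B * Real.exp y * D * C, k / 2,
    by positivity, by positivity, fun x hx ξ hξ hξy => ?_⟩
  have hx0 : 0 < x := by linarith
  have h2X := two_mul_kernelArg hx0 hy hξ
  have hX0 := kernelArg_pos hx0 hy hξ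
  refine (weightM_mul_kernelQ_le ha hx0 hy hξ).trans ?_
  rw [← hB]
  generalize kernelArg x y ξ = X at *
  have hi : 0 < ξ⁻¹ := by positivity
  have hyi : 0 < y⁻¹ := by positivity
  obtain ⟨S, hS⟩ : ∃ S, S = ξ + ξ⁻¹ := ⟨_, rfl⟩
  have hξS : ξ ≤ S := by linarith
  have hiS : ξ⁻¹ ≤ S := by linarith
  have hS2 : 2 ≤ S := by
    have : S - 2 = (ξ - 1) ^ 2 / ξ := by
      rw [hS]
      field_simp
      ring
    have : 0 ≤ (ξ - 1) ^ 2 / ξ := by positivity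
    linarith
  have hθ : S / (y * L) ≤ (ξ - y) ^ 2 / (y * ξ) := by
    have h1 : 1 + ξ ^ 2 ≤ (ξ - y) ^ 2 * L := by
      have h3 : δ ^ 2 ≤ (ξ - y) ^ 2 := by
        rw [← sq_abs (ξ - y)]
        gcongr
      have h4 : 1 + 2 * y ^ 2 ≤ (ξ - y) ^ 2 * ((1 + 2 * y ^ 2) / δ ^ 2) := by
        rw [mul_div_assoc', le_div_iff₀ (by positivity)]
        nlinarith [sq_nonneg y]
      rw [hL]
      nlinarith [sq_nonneg (ξ - 2 * y)]
    rw [show S = (1 + ξ ^ 2) / ξ by rw [hS]; field_simp; ring, div_div,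
      div_le_div_iff₀ (by positivity) (by positivity)]
    have : 0 < y * ξ := by positivity
    nlinarith
  have b1 : x ^ a * ξ⁻¹ ^ (a + 1) ≤ x ^ (a + 1) * S ^ (a + 1) * x⁻¹ := by
    rw [Real.rpow_add_one hx0.ne']
    have : ξ⁻¹ ^ (a + 1) ≤ S ^ (a + 1) := by gcongr
    have h5 : 0 < x ^ a := by positivity
    calc x ^ a * ξ⁻¹ ^ (a + 1) ≤ x ^ a * S ^ (a + 1) := by gcongr
      _ = _ := by field_simp
  have b2 : Real.exp (x + y - X) ≤ Real.exp y * Real.exp (-(k * (x * S))) *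
      Real.exp (-(k * (x * S))) := by
    rw [← Real.exp_add, ← Real.exp_add, Real.exp_le_exp]
    have h1 : x * (S / (y * L)) ≤ x * ((ξ - y) ^ 2 / (y * ξ)) := by gcongr
    have h2 : x * ((ξ - y) ^ 2 / (y * ξ)) = x * y / ξ + x * ξ / y - 2 * x := by
      field_simp
      ring
    have h3 : x * (S / (y * L)) = 8 * (k * (x * S)) := by
      rw [hk]
      field_simp
    have h4 : 0 < y * ξ / x := by positivity
    linarith
  have b3 : X + a ≤ D * (x * S) := by
    have h1 : x * y / ξ = x * (y * ξ⁻¹) := by field_simp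
    have h2 : x * ξ / y = x * (y⁻¹ * ξ) := by field_simp
    have h3 : y * ξ / x ≤ x * (y * ξ) := by
      rw [div_le_iff₀ hx0]
      nlinarith [mul_pos hy hξ, mul_pos (mul_pos hy hξ) hx0]
    have h4 : X + a ≤ x * ((1 + y + ξ) / 2 + (y * ξ⁻¹ + y⁻¹ * ξ + y * ξ) / 4 + a) := by
      nlinarith [mul_pos hx0 hξ]
    refine h4.trans ?_
    rw [mul_left_comm, hD]
    gcongr
    have g1 : y * ξ⁻¹ ≤ y * S := by gcongr
    have g2 : y⁻¹ * ξ ≤ y⁻¹ * S := by gcongr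
    have g3 : y * ξ ≤ y * S := by gcongr
    have g4 : y ≤ y * S := le_mul_of_one_le_right hy.le (by linarith)
    have g5 : a ≤ a * S := le_mul_of_one_le_right ha (by linarith)
    have g6 : 0 < y⁻¹ * S := by positivity
    linarith
  have b4 := hs (x * S) (by positivity)
  have b5 : Real.exp (-(k * (x * S))) ≤ Real.exp (-(k / 2 * x)) * Real.exp (-(k / 2 * ξ)) := by
    rw [← Real.exp_add, Real.exp_le_exp]
    have g1 : x ≤ x * S := le_mul_of_one_le_right hx0.le (by linarith)
    have g2 : S ≤ x * S := le_mul_of_one_le_left (by linarith) hx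
    have g3 : k / 2 * (x + ξ) ≤ k / 2 * (2 * (x * S)) := by
      gcongr
      linarith
    linarith
  calc B * (x ^ a * ξ⁻¹ ^ (a + 1)) * Real.exp (x + y - X) * (X + a)
      ≤ B * (x ^ (a + 1) * S ^ (a + 1) * x⁻¹) *
        (Real.exp y * Real.exp (-(k * (x * S))) * Real.exp (-(k * (x * S)))) *
        (D * (x * S)) := by
        gcongr
    _ = B * Real.exp y * D * x⁻¹ *
        ((x * S) ^ (a + 2) * Real.exp (-(k * (x * S)))) * Real.exp (-(k * (x * S))) := by
        rw [show a + 2 = a + 1 + 1 by ring, Real.rpow_add_one (by positivity : x * S ≠ 0),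
          Real.mul_rpow hx0.le (by positivity)]
        ring
    _ ≤ B * Real.exp y * D * 1 *
        C * (Real.exp (-(k / 2 * x)) * Real.exp (-(k / 2 * ξ))) := by
        gcongr
        exact inv_le_one_of_one_le₀ hx
    _ = _ := by ring

/-- For small `x` the term `yξ/(4x)` of the exponent dominates. With `s = ξ/x` it gives `e^{-ys/4}`;
half of this absorbs the linear factor in `s`. -/
theorem exists_weightM_mul_kernelQ_le_zero {a y δ : ℝ} (ha : 0 ≤ a) (hy : 0 < y) (hδ : 0 < δ) :
    ∃ C k : ℝ, 0 < C ∧ 0 < k ∧ ∀ x : ℝ, 0 < x → x ≤ 1 → x ≤ y → ∀ ξ : ℝ, δ ≤ ξ →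
      weightM a ξ * kernelQ a x y ξ ≤ C * Real.exp (-(k / x)) * Real.exp (-(k * ξ)) := by
  obtain ⟨C, hC, hs⟩ := exists_rpow_mul_exp_neg_le (N := 1) zero_le_one
    (show 0 < y / 8 by positivity)
  have hD : 0 < (1 + y + a) * δ⁻¹ + 1 + y⁻¹ + y + y * (δ⁻¹) ^ 2 := by positivity
  set D := (1 + y + a) * δ⁻¹ + 1 + y⁻¹ + y + y * (δ⁻¹) ^ 2 with hDdef
  have hk : 0 < y / 16 * min δ 1 := by positivity
  refine ⟨(y / 2) ^ (-(1 / 2) - a) * y ^ a * δ⁻¹ ^ (a + 1) * Real.exp y * D * C,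
    y / 16 * min δ 1, by positivity, hk, fun x hx hx1 hxy ξ hξδ => ?_⟩
  have hξ : 0 < ξ := hδ.trans_le hξδ
  have h2X := two_mul_kernelArg hx hy hξ
  have hX0 := kernelArg_pos hx hy hξ
  refine (weightM_mul_kernelQ_le ha hx hy hξ).trans ?_
  generalize kernelArg x y ξ = X at *
  have hδi : ξ⁻¹ ≤ δ⁻¹ := inv_anti₀ hδ hξδ
  have b1 : x ^ a * ξ⁻¹ ^ (a + 1) ≤ δ⁻¹ ^ (a + 1) := by
    calc x ^ a * ξ⁻¹ ^ (a + 1) ≤ 1 * δ⁻¹ ^ (a + 1) := by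
          gcongr
          exact Real.rpow_le_one hx.le hx1 ha
      _ = _ := one_mul _
  set s := ξ / x with hs'
  have hs0 : 0 < s := by positivity
  have hξs : ξ ≤ s := le_div_self hξ.le hx hx1
  have b2 : Real.exp (x + y - X) ≤ Real.exp y * Real.exp (-(y / 8 * s)) *
      Real.exp (-(y / 8 * s)) := by
    rw [← Real.exp_add, ← Real.exp_add, Real.exp_le_exp]
    have h1 : y * ξ / x = y * s := by rw [hs']; ring
    have h2 : 0 < x * y / ξ + x * ξ / y := by positivity
    linarith
  have b3 : X + a ≤ D * s := by
    have h0 : 1 ≤ δ⁻¹ * s := by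
      rw [inv_mul_eq_div, le_div_iff₀ hδ]
      linarith
    have h1 : x * y / ξ ≤ y * (δ⁻¹) ^ 2 * s := by
      calc x * y / ξ = x * y * ξ⁻¹ * 1 := by ring
        _ ≤ 1 * y * δ⁻¹ * (δ⁻¹ * s) := by gcongr
        _ = _ := by ring
    have h2 : x * ξ / y ≤ y⁻¹ * s := by
      calc x * ξ / y = x * ξ * y⁻¹ := by ring
        _ ≤ 1 * s * y⁻¹ := by gcongr
        _ = _ := by ring
    have h3 : y * ξ / x = y * s := by rw [hs']; ring
    have h4 : 1 + y + a ≤ (1 + y + a) * (δ⁻¹ * s) := le_mul_of_one_le_right (by positivity) h0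
    have h5 : 0 < y⁻¹ * s := by positivity
    have h6 : 0 < y * s := by positivity
    have h7 : 0 < y * (δ⁻¹) ^ 2 * s := by positivity
    rw [hDdef]
    linarith
  have b4 := hs s hs0
  rw [Real.rpow_one] at b4
  -- Both `δ/x` and `ξ` are at most `s`, since `ξ ≥ δ` and `x ≤ 1`; the minimum with 1 serves the
  -- two at once.
  have b5 : Real.exp (-(y / 8 * s)) ≤ Real.exp (-(y / 16 * min δ 1 / x)) *
      Real.exp (-(y / 16 * min δ 1 * ξ)) := by
    rw [← Real.exp_add, Real.exp_le_exp]
    have h1 : min δ 1 / x ≤ s := by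
      rw [hs']
      gcongr
      exact (min_le_left _ _).trans hξδ
    have h2 : min δ 1 * ξ ≤ s := by
      have := min_le_right δ 1
      nlinarith
    have h3 : y / 16 * min δ 1 / x = y / 16 * (min δ 1 / x) := by ring
    rw [h3]
    nlinarith
  calc (y / 2) ^ (-(1 / 2) - a) * y ^ a * (x ^ a * ξ⁻¹ ^ (a + 1)) * Real.exp (x + y - X) * (X + a)
      ≤ (y / 2) ^ (-(1 / 2) - a) * y ^ a * δ⁻¹ ^ (a + 1) *
        (Real.exp y * Real.exp (-(y / 8 * s)) * Real.exp (-(y / 8 * s))) * (D * s) := by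
        gcongr
    _ = (y / 2) ^ (-(1 / 2) - a) * y ^ a * δ⁻¹ ^ (a + 1) * Real.exp y * D *
        (s * Real.exp (-(y / 8 * s))) * Real.exp (-(y / 8 * s)) := by ring
    _ ≤ (y / 2) ^ (-(1 / 2) - a) * y ^ a * δ⁻¹ ^ (a + 1) * Real.exp y * D * C *
        (Real.exp (-(y / 16 * min δ 1 / x)) * Real.exp (-(y / 16 * min δ 1 * ξ))) := by
        gcongr
    _ = _ := by ring

/-! ### The translation as an averaging operator -/

instance (a : ℝ) : SFinite (measureM a) := by
  unfold measureM
  infer_instance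

theorem ae_measureM_pos (a : ℝ) : ∀ᵐ ξ ∂measureM a, 0 < ξ :=
  (withDensity_absolutelyContinuous _ _).ae_le (ae_restrict_mem measurableSet_Ioi)

theorem aestronglyMeasurable_kernelQ_smul {a x y : ℝ} (ha : 0 ≤ a) {E : Type*}
    [NormedAddCommGroup E] [NormedSpace ℝ E] {f : ℝ → E}
    (hf : AEStronglyMeasurable f (measureM a)) :
    AEStronglyMeasurable (fun ξ => kernelQ a x y ξ • f ξ) (measureM a) :=
  (measurable_kernelQ ha measurable_const measurable_const
    measurable_id).aestronglyMeasurable.smul hf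

theorem measurable_kernelQ_right {a x y : ℝ} (ha : 0 ≤ a) : Measurable fun ξ => kernelQ a x y ξ :=
  measurable_kernelQ ha measurable_const measurable_const measurable_id

theorem lintegral_enorm_kernelQ_smul {a x y : ℝ} (ha : 0 ≤ a) (hx : 0 < x) (hy : 0 < y)
    {E : Type*} [NormedAddCommGroup E] [NormedSpace ℝ E] (f : ℝ → E) :
    ∫⁻ ξ, ‖kernelQ a x y ξ • f ξ‖ₑ ∂measureM a =
      ∫⁻ ξ, ENNReal.ofReal (kernelQ a x y ξ) * ‖f ξ‖ₑ ∂measureM a := by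
  refine lintegral_congr_ae ((ae_measureM_pos a).mono fun ξ hξ => ?_)
  simp only
  rw [enorm_smul, Real.enorm_of_nonneg (kernelQ_pos ha hx hy hξ).le]

theorem enorm_translation_le {a x y : ℝ} (ha : 0 ≤ a) (hx : 0 < x) (hy : 0 < y)
    {E : Type*} [NormedAddCommGroup E] [NormedSpace ℝ E] (f : ℝ → E) :
    ‖translation a y f x‖ₑ ≤
      ∫⁻ ξ, ENNReal.ofReal (kernelQ a x y ξ) * ‖f ξ‖ₑ ∂measureM a :=
  (enorm_integral_le_lintegral_enorm _).trans (lintegral_enorm_kernelQ_smul ha hx hy f).le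

theorem integrable_kernelQ {a x y : ℝ} (ha : 0 ≤ a) (hx : 0 < x) (hy : 0 < y) :
    Integrable (kernelQ a x y) (measureM a) := by
  refine (lintegral_ofReal_ne_top_iff_integrable
    (measurable_kernelQ_right ha).aestronglyMeasurable
    ((ae_measureM_pos a).mono fun ξ hξ => (kernelQ_pos ha hx hy hξ).le)).1 ?_
  rw [lintegral_kernelQ ha hx hy]
  exact ENNReal.one_ne_top

theorem integral_kernelQ {a x y : ℝ} (ha : 0 ≤ a) (hx : 0 < x) (hy : 0 < y) :
    ∫ ξ, kernelQ a x y ξ ∂measureM a = 1 := by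
  rw [integral_eq_lintegral_of_nonneg_ae
    ((ae_measureM_pos a).mono fun ξ hξ => (kernelQ_pos ha hx hy hξ).le)
    (measurable_kernelQ_right ha).aestronglyMeasurable, lintegral_kernelQ ha hx hy,
    ENNReal.toReal_one]

theorem translation_mem_Icc {a x y : ℝ} (ha : 0 ≤ a) (hx : 0 < x) (hy : 0 < y) {f : ℝ → ℝ}
    (hf : ∀ᵐ ξ ∂measureM a, 0 ≤ f ξ ∧ f ξ ≤ 1) :
    0 ≤ translation a y f x ∧ translation a y f x ≤ 1 := by
  have h0 : 0 ≤ᵐ[measureM a] fun ξ => kernelQ a x y ξ • f ξ := by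
    filter_upwards [hf, ae_measureM_pos a] with ξ h hξ
    exact mul_nonneg (kernelQ_pos ha hx hy hξ).le h.1
  refine ⟨integral_nonneg_of_ae h0, ?_⟩
  rw [← integral_kernelQ ha hx hy]
  refine integral_mono_of_nonneg h0 (integrable_kernelQ ha hx hy) ?_
  filter_upwards [hf, ae_measureM_pos a] with ξ h hξ
  exact mul_le_of_le_one_right (kernelQ_pos ha hx hy hξ).le h.2

/-- Jensen's inequality, as monotonicity of `L_p` norms in the exponent for the probability measure
with density `q_a(x, y, ·)`. -/
theorem lintegral_kernelQ_mul_rpow_le {a x y r : ℝ} (ha : 0 ≤ a) (hx : 0 < x) (hy : 0 < y)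
    (hr : 1 ≤ r) {E : Type*} [NormedAddCommGroup E] {f : ℝ → E}
    (hf : AEStronglyMeasurable f (measureM a)) :
    (∫⁻ ξ, ENNReal.ofReal (kernelQ a x y ξ) * ‖f ξ‖ₑ ∂measureM a) ^ r ≤
      ∫⁻ ξ, ENNReal.ofReal (kernelQ a x y ξ) * ‖f ξ‖ₑ ^ r ∂measureM a := by
  have hr0 : 0 < r := by linarith
  have hq : Measurable fun ξ => ENNReal.ofReal (kernelQ a x y ξ) :=
    (measurable_kernelQ_right ha).ennreal_ofReal
  have hqt : ∀ᵐ ξ ∂measureM a, ENNReal.ofReal (kernelQ a x y ξ) < ∞ :=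
    ae_of_all _ fun _ => ENNReal.ofReal_lt_top
  set κ := (measureM a).withDensity fun ξ => ENNReal.ofReal (kernelQ a x y ξ) with hκ
  have : IsProbabilityMeasure κ := by
    refine ⟨?_⟩
    rw [hκ, withDensity_apply _ MeasurableSet.univ, Measure.restrict_univ,
      lintegral_kernelQ ha hx hy]
  have h := eLpNorm_le_eLpNorm_of_exponent_le (p := 1) (q := ENNReal.ofReal r) (μ := κ)
    (ENNReal.one_le_ofReal.2 hr) (hf.mono_ac (withDensity_absolutelyContinuous _ _))
  rw [eLpNorm_one_eq_lintegral_enorm, eLpNorm_eq_lintegral_rpow_enorm_toReal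
    (by simpa using hr0) ENNReal.ofReal_ne_top, ENNReal.toReal_ofReal hr0.le, one_div,
    ENNReal.le_rpow_inv_iff hr0, hκ,
    lintegral_withDensity_eq_lintegral_mul_non_measurable _ hq hqt,
    lintegral_withDensity_eq_lintegral_mul_non_measurable _ hq hqt] at h
  exact h

/-- After Jensen and Tonelli the kernel is integrated in `x`, where by symmetry its mass is again 1.
-/
theorem lintegral_lintegral_kernelQ_le {a y r : ℝ} (ha : 0 ≤ a) (hy : 0 < y)
    (hr : 1 ≤ r) {E : Type*} [NormedAddCommGroup E] {f : ℝ → E}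
    (hf : AEStronglyMeasurable f (measureM a)) :
    ∫⁻ x, (∫⁻ ξ, ENNReal.ofReal (kernelQ a x y ξ) * ‖f ξ‖ₑ ∂measureM a) ^ r ∂measureM a ≤
      ∫⁻ ξ, ‖f ξ‖ₑ ^ r ∂measureM a := by
  calc ∫⁻ x, (∫⁻ ξ, ENNReal.ofReal (kernelQ a x y ξ) * ‖f ξ‖ₑ ∂measureM a) ^ r ∂measureM a
      ≤ ∫⁻ x, ∫⁻ ξ, ENNReal.ofReal (kernelQ a x y ξ) * ‖f ξ‖ₑ ^ r ∂measureM a ∂measureM a :=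
        lintegral_mono_ae ((ae_measureM_pos a).mono fun x hx =>
          lintegral_kernelQ_mul_rpow_le ha hx hy hr hf)
    _ = ∫⁻ ξ, ∫⁻ x, ENNReal.ofReal (kernelQ a x y ξ) * ‖f ξ‖ₑ ^ r ∂measureM a ∂measureM a := by
        refine lintegral_lintegral_swap ?_
        refine AEMeasurable.mul ?_ ?_
        · exact (measurable_kernelQ ha measurable_fst measurable_const
            measurable_snd).ennreal_ofReal.aemeasurable
        · exact (hf.comp_snd.enorm).pow_const r
    _ = ∫⁻ ξ, ‖f ξ‖ₑ ^ r ∂measureM a := by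
        refine lintegral_congr_ae ((ae_measureM_pos a).mono fun ξ hξ => ?_)
        simp only
        simp_rw [kernelQ_swap_outer a _ y ξ]
        rw [lintegral_mul_const _ (measurable_kernelQ_right ha).ennreal_ofReal,
          lintegral_kernelQ ha hξ hy, one_mul]

theorem aestronglyMeasurable_translation {a y : ℝ} (ha : 0 ≤ a) {E : Type*}
    [NormedAddCommGroup E] [NormedSpace ℝ E] {f : ℝ → E}
    (hf : AEStronglyMeasurable f (measureM a)) :
    AEStronglyMeasurable (translation a y f) (measureM a) := by
  refine AEStronglyMeasurable.integral_prod_right'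
    (f := fun p : ℝ × ℝ => kernelQ a p.1 y p.2 • f p.2) ?_
  exact (measurable_kernelQ ha measurable_fst measurable_const
    measurable_snd).aestronglyMeasurable.smul hf.comp_snd

theorem lintegral_kernelQ_mul_le_eLpNorm_top {a x y : ℝ} (ha : 0 ≤ a) (hx : 0 < x) (hy : 0 < y)
    {E : Type*} [NormedAddCommGroup E] (f : ℝ → E) :
    ∫⁻ ξ, ENNReal.ofReal (kernelQ a x y ξ) * ‖f ξ‖ₑ ∂measureM a ≤ eLpNorm f ∞ (measureM a) := by
  calc ∫⁻ ξ, ENNReal.ofReal (kernelQ a x y ξ) * ‖f ξ‖ₑ ∂measureM a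
      ≤ ∫⁻ ξ, ENNReal.ofReal (kernelQ a x y ξ) * eLpNorm f ∞ (measureM a) ∂measureM a := by
        rw [eLpNorm_exponent_top]
        refine lintegral_mono_ae ((enorm_ae_le_eLpNormEssSup f _).mono fun ξ h => ?_)
        gcongr
    _ = _ := by
        rw [lintegral_mul_const _ (measurable_kernelQ_right ha).ennreal_ofReal,
          lintegral_kernelQ ha hx hy, one_mul]

theorem eLpNorm_translation_le {a y : ℝ} (ha : 0 ≤ a) (hy : 0 < y) {p : ℝ≥0∞} (hp : 1 ≤ p)
    {E : Type*} [NormedAddCommGroup E] [NormedSpace ℝ E] {f : ℝ → E}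
    (hf : AEStronglyMeasurable f (measureM a)) :
    eLpNorm (translation a y f) p (measureM a) ≤ eLpNorm f p (measureM a) := by
  by_cases hpt : p = ∞
  · subst hpt
    rw [eLpNorm_exponent_top (f := translation a y f)]
    refine eLpNormEssSup_le_of_ae_enorm_bound ((ae_measureM_pos a).mono fun x hx => ?_)
    exact (enorm_translation_le ha hx hy f).trans
      (lintegral_kernelQ_mul_le_eLpNorm_top ha hx hy f)
  · have hp0 : p ≠ 0 := (zero_lt_one.trans_le hp).ne'
    have hr : 1 ≤ p.toReal := by
      simpa using ENNReal.toReal_mono hpt hp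
    rw [eLpNorm_eq_lintegral_rpow_enorm_toReal hp0 hpt,
      eLpNorm_eq_lintegral_rpow_enorm_toReal hp0 hpt]
    refine ENNReal.rpow_le_rpow ?_ (by positivity)
    refine le_trans (lintegral_mono_ae ?_) (lintegral_lintegral_kernelQ_le ha hy hr hf)
    refine (ae_measureM_pos a).mono fun x hx => ?_
    exact ENNReal.rpow_le_rpow (enorm_translation_le ha hx hy f) (by linarith)

theorem ae_integrable_kernelQ_smul {a y : ℝ} (ha : 0 ≤ a) (hy : 0 < y) {p : ℝ≥0∞} (hp : 1 ≤ p)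
    {E : Type*} [NormedAddCommGroup E] [NormedSpace ℝ E] {f : ℝ → E}
    (hf : MemLp f p (measureM a)) :
    ∀ᵐ x ∂measureM a, Integrable (fun ξ => kernelQ a x y ξ • f ξ) (measureM a) := by
  have key : ∀ᵐ x ∂measureM a,
      ∫⁻ ξ, ENNReal.ofReal (kernelQ a x y ξ) * ‖f ξ‖ₑ ∂measureM a < ∞ := by
    by_cases hpt : p = ∞
    · subst hpt
      exact (ae_measureM_pos a).mono fun x hx =>
        (lintegral_kernelQ_mul_le_eLpNorm_top ha hx hy f).trans_lt hf.2
    · have hp0 : p ≠ 0 := (zero_lt_one.trans_le hp).ne'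
      have hr : 1 ≤ p.toReal := by
        simpa using ENNReal.toReal_mono hpt hp
      have hfin := (lintegral_lintegral_kernelQ_le ha hy hr hf.1).trans_lt
        (lintegral_rpow_enorm_lt_top_of_eLpNorm_lt_top hp0 hpt hf.2)
      have hm : AEMeasurable (fun x => (∫⁻ ξ, ENNReal.ofReal (kernelQ a x y ξ) * ‖f ξ‖ₑ
          ∂measureM a) ^ p.toReal) (measureM a) := by
        refine AEMeasurable.pow_const ?_ _
        refine AEMeasurable.lintegral_prod_right'
          (f := fun q : ℝ × ℝ => ENNReal.ofReal (kernelQ a q.1 y q.2) * ‖f q.2‖ₑ) ?_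
        exact (measurable_kernelQ ha measurable_fst measurable_const
          measurable_snd).ennreal_ofReal.aemeasurable.mul hf.1.comp_snd.enorm
      refine (ae_lt_top' hm hfin.ne).mono fun x hx => ?_
      exact (ENNReal.rpow_lt_top_iff_of_pos (by linarith)).1 hx
  filter_upwards [key, ae_measureM_pos a] with x h hx
  refine ⟨aestronglyMeasurable_kernelQ_smul ha hf.1, ?_⟩
  rw [HasFiniteIntegral, lintegral_enorm_kernelQ_smul ha hx hy]
  exact h

/-! ### Continuity -/

/-- The `r`-th power times the weight is `ξ^{(2a+1)(r-1)} e^{-ξ/2}`, with nonnegative power because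
`r ≥ 1`. -/
theorem memLp_dominating {a : ℝ} (ha : 0 ≤ a) {p : ℝ≥0∞} (hp : 1 ≤ p) (hpt : p ≠ ∞) :
    MemLp (fun ξ : ℝ => ξ ^ (2 * a + 1) * Real.exp (ξ / (2 * p.toReal))) p (measureM a) := by
  have hp0 : p ≠ 0 := (zero_lt_one.trans_le hp).ne'
  have hr : 1 ≤ p.toReal := by simpa using ENNReal.toReal_mono hpt hp
  set r := p.toReal
  refine ⟨Measurable.aestronglyMeasurable (by fun_prop), ?_⟩
  refine (eLpNorm_lt_top_iff_lintegral_rpow_enorm_lt_top hp0 hpt).2 ?_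
  have hI := integrableOn_rpow_mul_exp_neg_mul_rpow (s := (2 * a + 1) * (r - 1)) (p := 1)
    (b := 1 / 2) (by nlinarith) one_pos (by norm_num)
  refine lt_of_le_of_lt (le_of_eq ?_) hI.lintegral_lt_top
  rw [lintegral_measureM]
  refine setLIntegral_congr_fun measurableSet_Ioi fun ξ hξ => ?_
  have hξ' : (0 : ℝ) < ξ := hξ
  have h0 : 0 ≤ ξ ^ (2 * a + 1) * Real.exp (ξ / (2 * r)) := by positivity
  rw [Real.enorm_of_nonneg h0, ENNReal.ofReal_rpow_of_nonneg h0 (by linarith),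
    ← ENNReal.ofReal_mul (weightM_pos a hξ').le, Real.mul_rpow (by positivity) (by positivity),
    ← Real.rpow_mul hξ'.le, ← Real.exp_mul, weightM]
  congr 1
  rw [show ξ / (2 * r) * r = ξ / 2 by field_simp,
    show ξ ^ (-2 * a - 1) * Real.exp (-ξ) * (ξ ^ ((2 * a + 1) * r) * Real.exp (ξ / 2)) =
      (ξ ^ (-2 * a - 1) * ξ ^ ((2 * a + 1) * r)) * (Real.exp (-ξ) * Real.exp (ξ / 2)) by ring,
    ← Real.rpow_add hξ', ← Real.exp_add, Real.rpow_one]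
  ring_nf

/-- Hölder's inequality with the conjugate exponent, which is finite because `p > 1`. The lower
bound on `h` serves to make compactly supported `f` integrable later. -/
theorem exists_integrable_bound {a M : ℝ} (ha : 0 ≤ a) (hM : 0 < M) {p : ℝ≥0∞} (hp : 1 < p)
    {E : Type*} [NormedAddCommGroup E] {f : ℝ → E} (hf : MemLp f p (measureM a)) :
    ∃ h : ℝ → ℝ, (∀ ξ, 0 < ξ → ξ ^ (2 * a + 1) ≤ h ξ) ∧
      Integrable (fun ξ => h ξ * ‖f ξ‖) (measureM a) ∧ ∃ K : ℝ, 0 < K ∧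
      ∀ x ∈ Icc M⁻¹ M, ∀ y ∈ Icc M⁻¹ M, ∀ ξ : ℝ, 0 < ξ → kernelQ a x y ξ ≤ K * h ξ := by
  have hc := ENNReal.HolderConjugate.conjExponent hp.le
  set q := p.conjExponent with hq
  have hq1 : 1 ≤ q := hc.symm.one_le
  have hqt : q ≠ ∞ := by
    rw [hq, ENNReal.conjExponent]
    simp [tsub_eq_zero_iff_le, hp]
  have hr : 1 ≤ q.toReal := by simpa using ENNReal.toReal_mono hqt hq1
  obtain ⟨K, hK, hb⟩ := exists_kernelQ_le ha hM hr
  refine ⟨_, fun ξ hξ => ?_, (memLp_dominating ha hq1 hqt).integrable_mul hf.norm, K, hK, hb⟩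
  exact le_mul_of_one_le_right (by positivity) (Real.one_le_exp (by positivity))

theorem exists_mem_Ioo_inv {x y : ℝ} (hx : 0 < x) (hy : 0 < y) :
    ∃ M : ℝ, 0 < M ∧ x ∈ Ioo M⁻¹ M ∧ y ∈ Ioo M⁻¹ M := by
  have h0 : 0 < x + y + x⁻¹ + y⁻¹ := by positivity
  have hx' := inv_pos.2 hx
  have hy' := inv_pos.2 hy
  exact ⟨x + y + x⁻¹ + y⁻¹, h0, ⟨inv_lt_of_inv_lt₀ hx (by linarith), by linarith⟩,
    ⟨inv_lt_of_inv_lt₀ hy (by linarith), by linarith⟩⟩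

theorem integrable_kernelQ_smul {a x y : ℝ} (ha : 0 ≤ a) (hx : 0 < x) (hy : 0 < y) {p : ℝ≥0∞}
    (hp : 1 < p) {E : Type*} [NormedAddCommGroup E] [NormedSpace ℝ E] {f : ℝ → E}
    (hf : MemLp f p (measureM a)) :
    Integrable (fun ξ => kernelQ a x y ξ • f ξ) (measureM a) := by
  obtain ⟨M, hM, hxM, hyM⟩ := exists_mem_Ioo_inv hx hy
  obtain ⟨h, -, hi, K, hK, hb⟩ := exists_integrable_bound ha hM hp hf
  refine (hi.const_mul K).mono' (aestronglyMeasurable_kernelQ_smul ha hf.1) ?_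
  refine (ae_measureM_pos a).mono fun ξ hξ => ?_
  rw [norm_smul, Real.norm_of_nonneg (kernelQ_pos ha hx hy hξ).le, ← mul_assoc]
  gcongr
  exact hb x (Ioo_subset_Icc_self hxM) y (Ioo_subset_Icc_self hyM) ξ hξ

theorem continuousAt_translation {a x y : ℝ} (ha : 0 ≤ a) (hx : 0 < x) (hy : 0 < y) {p : ℝ≥0∞}
    (hp : 1 < p) {E : Type*} [NormedAddCommGroup E] [NormedSpace ℝ E] {f : ℝ → E}
    (hf : MemLp f p (measureM a)) : ContinuousAt (translation a y f) x := by
  obtain ⟨M, hM, hxM, hyM⟩ := exists_mem_Ioo_inv hx hy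
  obtain ⟨h, -, hi, K, hK, hb⟩ := exists_integrable_bound ha hM hp hf
  refine continuousAt_of_dominated (bound := fun ξ => K * (h ξ * ‖f ξ‖))
    (Eventually.of_forall fun t => aestronglyMeasurable_kernelQ_smul ha hf.1) ?_
    (hi.const_mul K) ?_
  · filter_upwards [Ioo_mem_nhds hxM.1 hxM.2] with t ht
    refine (ae_measureM_pos a).mono fun ξ hξ => ?_
    have ht0 : 0 < t := (inv_pos.2 hM).trans ht.1
    rw [norm_smul, Real.norm_of_nonneg (kernelQ_pos ha ht0 hy hξ).le, ← mul_assoc]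
    gcongr
    exact hb t (Ioo_subset_Icc_self ht) y (Ioo_subset_Icc_self hyM) ξ hξ
  · refine (ae_measureM_pos a).mono fun ξ hξ => ?_
    exact (continuousAt_kernelQ ha hx hy hξ).smul continuousAt_const

/-- Turns continuity in the translation parameter into continuity in the argument. -/
theorem translation_swap (a x y : ℝ) {E : Type*} [NormedAddCommGroup E] [NormedSpace ℝ E]
    (f : ℝ → E) : translation a y f x = translation a x f y := by
  unfold translation
  simp_rw [kernelQ_swap_left a x y]

theorem tendsto_eLpNorm_zero_of_dominated {α ι E : Type*} [MeasurableSpace α] {μ : Measure α}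
    [NormedAddCommGroup E] {l : Filter ι} [l.IsCountablyGenerated] {p : ℝ≥0∞} (hp0 : p ≠ 0)
    (hpt : p ≠ ∞) {F : ι → α → E} {g : α → ℝ}
    (hF : ∀ᶠ i in l, AEStronglyMeasurable (F i) μ) (hg : MemLp g p μ)
    (hb : ∀ᶠ i in l, ∀ᵐ x ∂μ, ‖F i x‖ ≤ g x) (hl : ∀ᵐ x ∂μ, Tendsto (fun i => F i x) l (𝓝 0)) :
    Tendsto (fun i => eLpNorm (F i) p μ) l (𝓝 0) := by
  have hr : 0 < p.toReal := ENNReal.toReal_pos hp0 hpt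
  have key : Tendsto (fun i => ∫⁻ x, ‖F i x‖ₑ ^ p.toReal ∂μ) l (𝓝 0) := by
    have := tendsto_lintegral_filter_of_dominated_convergence' (μ := μ) (l := l)
      (F := fun i x => ‖F i x‖ₑ ^ p.toReal) (f := fun _ => 0) (fun x => ‖g x‖ₑ ^ p.toReal)
      (hF.mono fun i hi => hi.enorm.pow_const _) ?_
      (lintegral_rpow_enorm_lt_top_of_eLpNorm_lt_top hp0 hpt hg.2).ne ?_
    · rw [lintegral_zero] at this
      exact this
    · refine hb.mono fun i hi => hi.mono fun x hx => ?_
      refine ENNReal.rpow_le_rpow ?_ hr.le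
      exact enorm_le_iff_norm_le.2 (hx.trans (le_abs_self _))
    · refine hl.mono fun x hx => ?_
      have := (hx.enorm).ennrpow_const p.toReal
      simpa [hr] using this
  have := key.ennrpow_const (1 / p.toReal)
  rw [ENNReal.zero_rpow_of_pos (by positivity)] at this
  refine this.congr fun i => ?_
  rw [eLpNorm_eq_lintegral_rpow_enorm_toReal hp0 hpt]

theorem translation_sub {a x y : ℝ} (ha : 0 ≤ a) (hx : 0 < x) (hy : 0 < y) {p : ℝ≥0∞}
    (hp : 1 < p) {E : Type*} [NormedAddCommGroup E] [NormedSpace ℝ E] {f g : ℝ → E}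
    (hf : MemLp f p (measureM a)) (hg : MemLp g p (measureM a)) :
    translation a y (f - g) x = translation a y f x - translation a y g x := by
  unfold translation
  rw [← integral_sub (integrable_kernelQ_smul ha hx hy hp hf)
    (integrable_kernelQ_smul ha hx hy hp hg)]
  simp_rw [Pi.sub_apply, smul_sub]

/-- When `ξ` and the parameter both stay in `[1/M, M]`, the translations are dominated by one
`L_p^a` function of `x`. Pointwise convergence comes from `translation_swap`, and dominated
convergence concludes. -/
theorem tendsto_eLpNorm_translation_of_support {a y M : ℝ} (ha : 0 ≤ a) (hM : 0 < M)
    (hy : y ∈ Ioo M⁻¹ M) {p : ℝ≥0∞} (hp : 1 < p) (hpt : p ≠ ∞) {E : Type*}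
    [NormedAddCommGroup E] [NormedSpace ℝ E] {f : ℝ → E} (hf : MemLp f p (measureM a))
    (hsupp : ∀ ξ ∉ Icc M⁻¹ M, f ξ = 0) :
    Tendsto (fun h => eLpNorm (fun x => translation a (y + h) f x - translation a y f x) p
      (measureM a)) (𝓝 0) (𝓝 0) := by
  have hp0 : p ≠ 0 := (zero_lt_one.trans hp).ne'
  have hr : 1 ≤ p.toReal := by simpa using ENNReal.toReal_mono hpt hp.le
  have hM' : 0 < M⁻¹ := inv_pos.2 hM
  have hy0 : 0 < y := hM'.trans hy.1
  have hfi : Integrable f (measureM a) := by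
    obtain ⟨h, hh, hi, -⟩ := exists_integrable_bound ha hM hp hf
    refine (hi.const_mul ((M⁻¹ ^ (2 * a + 1))⁻¹)).mono' hf.1 ?_
    refine (ae_measureM_pos a).mono fun ξ hξ => ?_
    by_cases hξM : ξ ∈ Icc M⁻¹ M
    · have h1 : M⁻¹ ^ (2 * a + 1) ≤ h ξ :=
        (Real.rpow_le_rpow hM'.le hξM.1 (by linarith)).trans (hh ξ hξ)
      have h2 : 0 < M⁻¹ ^ (2 * a + 1) := by positivity
      rw [← mul_assoc]
      refine le_mul_of_one_le_left (norm_nonneg _) ?_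
      rwa [inv_mul_eq_div, one_le_div h2]
    · simp [hsupp ξ hξM]
  obtain ⟨K, hK, hb⟩ := exists_kernelQ_le ha hM hr
  have hbound : ∀ t ∈ Icc M⁻¹ M, ∀ x, 0 < x → ‖translation a t f x‖ ≤
      K * (∫ ξ, ‖f ξ‖ ∂measureM a) * (x ^ (2 * a + 1) * Real.exp (x / (2 * p.toReal))) := by
    intro t ht x hx
    have ht0 : 0 < t := hM'.trans_le ht.1
    rw [mul_right_comm, ← integral_const_mul]
    refine norm_integral_le_of_norm_le (hfi.norm.const_mul _) ?_
    refine (ae_measureM_pos a).mono fun ξ hξ => ?_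
    by_cases hξM : ξ ∈ Icc M⁻¹ M
    · rw [norm_smul, Real.norm_of_nonneg (kernelQ_pos ha hx ht0 hξ).le]
      gcongr
      rw [kernelQ_swap_outer]
      exact hb ξ hξM t ht x hx
    · simp [hsupp ξ hξM]
  have hnear : ∀ᶠ h : ℝ in 𝓝 0, y + h ∈ Icc M⁻¹ M := by
    have : Tendsto (fun h : ℝ => y + h) (𝓝 0) (𝓝 y) := by
      have h : Continuous fun h : ℝ => y + h := by fun_prop
      simpa using h.tendsto 0
    exact this.eventually (Icc_mem_nhds hy.1 hy.2)
  refine tendsto_eLpNorm_zero_of_dominated hp0 hpt (g := fun x =>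
    2 * (K * ∫ ξ, ‖f ξ‖ ∂measureM a) * (x ^ (2 * a + 1) * Real.exp (x / (2 * p.toReal))))
    (Eventually.of_forall fun h => (aestronglyMeasurable_translation ha hf.1).sub
      (aestronglyMeasurable_translation ha hf.1))
    ((memLp_dominating ha hp.le hpt).const_mul _) ?_ ?_
  · filter_upwards [hnear] with h hh
    refine (ae_measureM_pos a).mono fun x hx => ?_
    refine (norm_sub_le _ _).trans ?_
    have h1 := hbound _ hh x hx
    have h2 := hbound _ (Ioo_subset_Icc_self hy) x hx
    linarith
  · refine (ae_measureM_pos a).mono fun x hx => ?_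
    have hc := continuousAt_translation ha hy0 hx hp hf
    have h1 : Tendsto (fun h : ℝ => translation a x f (y + h)) (𝓝 0) (𝓝 (translation a x f y)) := by
      refine hc.tendsto.comp ?_
      have h : Continuous fun h : ℝ => y + h := by fun_prop
      simpa using h.tendsto 0
    simp_rw [translation_swap a x]
    simpa using h1.sub_const (translation a x f y)

theorem tendsto_eLpNorm_sub_indicator {a : ℝ} {p : ℝ≥0∞} (hp0 : p ≠ 0) (hpt : p ≠ ∞) {E : Type*}
    [NormedAddCommGroup E] {f : ℝ → E} (hf : MemLp f p (measureM a)) :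
    Tendsto (fun M : ℝ => eLpNorm (f - (Icc M⁻¹ M).indicator f) p (measureM a)) atTop (𝓝 0) := by
  refine tendsto_eLpNorm_zero_of_dominated hp0 hpt (g := fun x => ‖f x‖)
    (Eventually.of_forall fun M => hf.1.sub (hf.1.indicator measurableSet_Icc)) hf.norm
    (Eventually.of_forall fun M => ae_of_all _ fun x => ?_) ?_
  · by_cases hx : x ∈ Icc M⁻¹ M <;> simp [hx]
  · refine (ae_measureM_pos a).mono fun x hx => ?_
    refine tendsto_const_nhds.congr' ?_
    filter_upwards [eventually_ge_atTop x, tendsto_inv_atTop_zero.eventually (ge_mem_nhds hx)]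
      with M h1 h2
    simp [indicator_of_mem (show x ∈ Icc M⁻¹ M from ⟨h2, h1⟩)]

/-- An `ε/3` argument: the error of truncating `f` to `[1/M, M]` is not enlarged by the contraction,
whatever `h` is. -/
theorem tendsto_eLpNorm_translation {a y : ℝ} (ha : 0 ≤ a) (hy : 0 < y) {p : ℝ≥0∞}
    (hp : 1 < p) (hpt : p ≠ ∞) {E : Type*} [NormedAddCommGroup E] [NormedSpace ℝ E] {f : ℝ → E}
    (hf : MemLp f p (measureM a)) :
    Tendsto (fun h => eLpNorm (fun x => translation a (y + h) f x - translation a y f x) p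
      (measureM a)) (𝓝 0) (𝓝 0) := by
  have hp0 : p ≠ 0 := (zero_lt_one.trans hp).ne'
  refine ENNReal.tendsto_nhds_zero.2 fun ε hε => ?_
  have hε3 : 0 < ε / 3 := ENNReal.div_pos hε.ne' (by norm_num)
  obtain ⟨M, h1, h2, h3⟩ := ((ENNReal.tendsto_nhds_zero.1
    (tendsto_eLpNorm_sub_indicator hp0 hpt hf) _ hε3).and ((eventually_gt_atTop y).and
    (tendsto_inv_atTop_zero.eventually (gt_mem_nhds hy)))).exists
  have hM : 0 < M := hy.trans h2
  set g := (Icc M⁻¹ M).indicator f with hg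
  have hgL : MemLp g p (measureM a) := hf.indicator measurableSet_Icc
  have hlim := ENNReal.tendsto_nhds_zero.1 (tendsto_eLpNorm_translation_of_support ha hM ⟨h3, h2⟩
    hp hpt hgL fun ξ hξ => indicator_of_notMem hξ f) _ hε3
  have hnear : ∀ᶠ h : ℝ in 𝓝 0, 0 < y + h := by
    filter_upwards [lt_mem_nhds (neg_lt_zero.2 hy)] with h hh
    linarith
  filter_upwards [hlim, hnear] with h hh hyh
  have hm : ∀ (t : ℝ) (k : ℝ → E), MemLp k p (measureM a) →
      AEStronglyMeasurable (translation a t k) (measureM a) := fun t k hk =>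
    aestronglyMeasurable_translation ha hk.1
  have hd := hf.sub hgL
  calc eLpNorm (fun x => translation a (y + h) f x - translation a y f x) p (measureM a)
      = eLpNorm (translation a (y + h) (f - g) + (fun x => translation a (y + h) g x -
          translation a y g x) - translation a y (f - g)) p (measureM a) := by
        refine eLpNorm_congr_ae ((ae_measureM_pos a).mono fun x hx => ?_)
        simp only [Pi.add_apply, Pi.sub_apply]
        rw [translation_sub ha hx hyh hp hf hgL, translation_sub ha hx hy hp hf hgL]
        abel
    _ ≤ eLpNorm (translation a (y + h) (f - g)) p (measureM a) +
          eLpNorm (fun x => translation a (y + h) g x - translation a y g x) p (measureM a) +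
          eLpNorm (translation a y (f - g)) p (measureM a) := by
        refine (eLpNorm_sub_le ((hm _ _ hd).add ((hm _ _ hgL).sub (hm _ _ hgL))) (hm _ _ hd)
          hp.le).trans ?_
        gcongr
        exact eLpNorm_add_le (hm _ _ hd) ((hm _ _ hgL).sub (hm _ _ hgL)) hp.le
    _ ≤ ε / 3 + ε / 3 + ε / 3 := by
        gcongr
        · exact (eLpNorm_translation_le ha hyh hp.le hd.1).trans h1
        · exact (eLpNorm_translation_le ha hy hp.le hd.1).trans h1
    _ = ε := ENNReal.add_thirds ε

/-! ### Limits at the end points -/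

theorem tendsto_setLIntegral_kernelQ {a y k : ℝ} (hk : 0 < k)
    {l : Filter ℝ} {t : Set ℝ} (ht : MeasurableSet t) {φ : ℝ → ℝ}
    (hφ : Tendsto φ l (𝓝 0)) (hb : ∀ᶠ x in l, 0 < x ∧ ∀ ξ ∈ t, 0 < ξ →
      weightM a ξ * kernelQ a x y ξ ≤ φ x * Real.exp (-(k * ξ))) :
    Tendsto (fun x => ∫⁻ ξ in t, ENNReal.ofReal (kernelQ a x y ξ) ∂measureM a) l (𝓝 0) := by
  have hI : ∫⁻ ξ in Ioi (0 : ℝ), ENNReal.ofReal (Real.exp (-(k * ξ))) ≠ ∞ := by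
    have := integrableOn_exp_mul_rpow one_pos hk
    simp only [sub_self, Real.rpow_zero, mul_one] at this
    exact this.lintegral_lt_top.ne
  have hlim : Tendsto (fun x => ENNReal.ofReal (φ x) *
      ∫⁻ ξ in Ioi (0 : ℝ), ENNReal.ofReal (Real.exp (-(k * ξ)))) l (𝓝 0) := by
    have := ENNReal.Tendsto.mul_const (ENNReal.tendsto_ofReal hφ) (Or.inr hI)
    simpa using this
  refine tendsto_of_tendsto_of_tendsto_of_le_of_le' tendsto_const_nhds hlim
    (Eventually.of_forall fun _ => zero_le) ?_
  filter_upwards [hb] with x ⟨hx, hxb⟩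
  rw [← lintegral_indicator ht, lintegral_measureM,
    ← lintegral_const_mul' _ _ ENNReal.ofReal_ne_top]
  refine setLIntegral_mono' measurableSet_Ioi fun ξ hξ => ?_
  by_cases h : ξ ∈ t
  · rw [indicator_of_mem h, ← ENNReal.ofReal_mul (weightM_pos a hξ).le,
      ← ENNReal.ofReal_mul' (Real.exp_pos _).le]
    exact ENNReal.ofReal_le_ofReal (hxb ξ h hξ)
  · simp [indicator_of_notMem h]

/-- The approximate-identity argument: on `t` the bound `C` meets vanishing mass, off `t` the bound
`ε` meets mass at most 1. The set `t` is `|ξ - y| ≥ δ` for the limit at infinity and `[δ, ∞)` for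
the limit at zero. -/
theorem tendsto_lintegral_kernelQ_mul {a y : ℝ} (ha : 0 ≤ a) (hy : 0 < y) {l : Filter ℝ}
    (hl : ∀ᶠ x in l, 0 < x) {g : ℝ → ℝ≥0∞} {C : ℝ≥0∞} (hC : C ≠ ∞)
    (hg : ∀ᵐ ξ ∂measureM a, g ξ ≤ C)
    (h : ∀ ε : ℝ≥0∞, 0 < ε → ∃ t : Set ℝ, MeasurableSet t ∧ (∀ ξ ∉ t, 0 < ξ → g ξ ≤ ε) ∧
      Tendsto (fun x => ∫⁻ ξ in t, ENNReal.ofReal (kernelQ a x y ξ) ∂measureM a) l (𝓝 0)) :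
    Tendsto (fun x => ∫⁻ ξ, ENNReal.ofReal (kernelQ a x y ξ) * g ξ ∂measureM a) l (𝓝 0) := by
  refine ENNReal.tendsto_nhds_zero.2 fun ε hε => ?_
  have hε2 : 0 < ε / 2 := ENNReal.half_pos hε.ne'
  obtain ⟨t, ht, hsmall, htail⟩ := h _ hε2
  have htail' : Tendsto (fun x => (∫⁻ ξ in t, ENNReal.ofReal (kernelQ a x y ξ) ∂measureM a) * C)
      l (𝓝 0) := by
    simpa using ENNReal.Tendsto.mul_const htail (Or.inr hC)
  filter_upwards [hl, ENNReal.tendsto_nhds_zero.1 htail' _ hε2] with x hx hxt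
  have hq : Measurable fun ξ => ENNReal.ofReal (kernelQ a x y ξ) :=
    (measurable_kernelQ_right ha).ennreal_ofReal
  rw [← lintegral_add_compl _ ht, ← ENNReal.add_halves ε]
  refine add_le_add (le_trans ?_ hxt) ?_
  · rw [← lintegral_mul_const _ hq]
    refine lintegral_mono_ae ((ae_restrict_of_ae hg).mono fun ξ hξ => ?_)
    gcongr
  · calc ∫⁻ ξ in tᶜ, ENNReal.ofReal (kernelQ a x y ξ) * g ξ ∂measureM a
        ≤ ∫⁻ ξ in tᶜ, ENNReal.ofReal (kernelQ a x y ξ) * (ε / 2) ∂measureM a := by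
          refine lintegral_mono_ae ?_
          filter_upwards [ae_restrict_mem ht.compl, ae_restrict_of_ae (ae_measureM_pos a)]
            with ξ h1 h2
          gcongr
          exact hsmall ξ h1 h2
      _ ≤ ∫⁻ ξ, ENNReal.ofReal (kernelQ a x y ξ) * (ε / 2) ∂measureM a :=
          setLIntegral_le_lintegral _ _
      _ = ε / 2 := by rw [lintegral_mul_const _ hq, lintegral_kernelQ ha hx hy, one_mul]

theorem tendsto_translation_atTop {a y : ℝ} (ha : 0 ≤ a) (hy : 0 < y) {E : Type*}
    [NormedAddCommGroup E] [NormedSpace ℝ E] [CompleteSpace E]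
    [SecondCountableTopologyEither ℝ E] {f : ℝ → E}
    (hf : ContinuousOn f (Ioi 0)) (hb : ∃ C : ℝ, ∀ x : ℝ, 0 < x → ‖f x‖ ≤ C) :
    Tendsto (translation a y f) atTop (𝓝 (f y)) := by
  obtain ⟨C, hC⟩ := hb
  have hfm : AEStronglyMeasurable f (measureM a) :=
    (hf.aestronglyMeasurable measurableSet_Ioi).mono_ac (withDensity_absolutelyContinuous _ _)
  have hfL : MemLp f ∞ (measureM a) :=
    memLp_top_of_bound hfm C ((ae_measureM_pos a).mono hC)
  have hlim : Tendsto (fun x => ∫⁻ ξ, ENNReal.ofReal (kernelQ a x y ξ) * ‖f ξ - f y‖ₑ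
      ∂measureM a) atTop (𝓝 0) := by
    refine tendsto_lintegral_kernelQ_mul ha hy (eventually_gt_atTop 0)
      (C := ENNReal.ofReal (C + C)) ENNReal.ofReal_ne_top ?_ fun ε hε => ?_
    · refine (ae_measureM_pos a).mono fun ξ hξ => ?_
      rw [← ofReal_norm]
      exact ENNReal.ofReal_le_ofReal ((norm_sub_le _ _).trans (add_le_add (hC ξ hξ) (hC y hy)))
    · have hcont : Tendsto (fun ξ => ‖f ξ - f y‖ₑ) (𝓝 y) (𝓝 0) := by
        have := ((hf.continuousAt (Ioi_mem_nhds hy)).tendsto.sub_const (f y)).enorm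
        simpa using this
      obtain ⟨δ, hδ, hball⟩ := Metric.eventually_nhds_iff.1 (ENNReal.tendsto_nhds_zero.1 hcont ε hε)
      obtain ⟨B, k, hB, hk, hk'⟩ := exists_weightM_mul_kernelQ_le_atTop ha hy hδ
      refine ⟨{ξ | δ ≤ |ξ - y|}, measurableSet_le measurable_const (by fun_prop),
        fun ξ hξ _ => hball ?_, ?_⟩
      · rw [Real.dist_eq]
        exact not_le.1 hξ
      · refine tendsto_setLIntegral_kernelQ hk (measurableSet_le measurable_const
          (by fun_prop)) (φ := fun x => B * Real.exp (-(k * x))) ?_ ?_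
        · have h1 : Tendsto (fun x : ℝ => k * x) atTop atTop := tendsto_id.const_mul_atTop hk
          simpa using (Real.tendsto_exp_neg_atTop_nhds_zero.comp h1).const_mul B
        · filter_upwards [eventually_ge_atTop 1] with x hx
          exact ⟨by linarith, fun ξ h1 h2 => hk' x hx ξ h2 h1⟩
  refine tendsto_iff_edist_tendsto_0.2 ?_
  refine tendsto_of_tendsto_of_tendsto_of_le_of_le' tendsto_const_nhds hlim
    (Eventually.of_forall fun _ => zero_le) ?_
  filter_upwards [eventually_gt_atTop 0] with x hx
  -- Mass 1 allows the constant `f y` to be brought under the integral.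
  have e : translation a y f x - f y = translation a y (fun ξ => f ξ - f y) x := by
    have h1 : ∫ ξ, kernelQ a x y ξ • f y ∂measureM a = f y := by
      rw [integral_smul_const, integral_kernelQ ha hx hy, one_smul]
    unfold translation
    nth_rewrite 1 [← h1]
    rw [← integral_sub (integrable_kernelQ_smul ha hx hy ENNReal.one_lt_top hfL)
      ((integrable_kernelQ ha hx hy).smul_const _)]
    simp_rw [smul_sub]
  rw [edist_eq_enorm_sub, e]
  exact enorm_translation_le ha hx hy _

theorem tendsto_translation_zero {a y : ℝ} (ha : 0 ≤ a) (hy : 0 < y) {E : Type*}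
    [NormedAddCommGroup E] [NormedSpace ℝ E] {f : ℝ → E} (hf : MemLp f ∞ (measureM a))
    (hf0 : Tendsto f (𝓝[>] 0) (𝓝 0)) : Tendsto (translation a y f) (𝓝[>] 0) (𝓝 0) := by
  have hpos : ∀ᶠ x : ℝ in 𝓝[>] 0, 0 < x := eventually_mem_nhdsWithin
  have hlim : Tendsto (fun x => ∫⁻ ξ, ENNReal.ofReal (kernelQ a x y ξ) * ‖f ξ‖ₑ
      ∂measureM a) (𝓝[>] 0) (𝓝 0) := by
    refine tendsto_lintegral_kernelQ_mul ha hy hpos hf.2.ne ?_ fun ε hε => ?_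
    · rw [eLpNorm_exponent_top]
      exact enorm_ae_le_eLpNormEssSup f _
    · have h0 : Tendsto (fun ξ => ‖f ξ‖ₑ) (𝓝[>] 0) (𝓝 0) := by simpa using hf0.enorm
      obtain ⟨δ, hδ, hsub⟩ := mem_nhdsGT_iff_exists_Ioo_subset.1
        (ENNReal.tendsto_nhds_zero.1 h0 ε hε)
      obtain ⟨B, k, hB, hk, hk'⟩ := exists_weightM_mul_kernelQ_le_zero ha hy hδ
      refine ⟨Ici δ, measurableSet_Ici, fun ξ h1 h2 => hsub ⟨h2, not_le.1 h1⟩, ?_⟩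
      refine tendsto_setLIntegral_kernelQ hk measurableSet_Ici
        (φ := fun x => B * Real.exp (-(k / x))) ?_ ?_
      · have h1 : Tendsto (fun x : ℝ => k * x⁻¹) (𝓝[>] 0) atTop :=
          tendsto_inv_nhdsGT_zero.const_mul_atTop hk
        simpa [div_eq_mul_inv] using (Real.tendsto_exp_neg_atTop_nhds_zero.comp h1).const_mul B
      · filter_upwards [hpos, mem_nhdsWithin_of_mem_nhds (ge_mem_nhds one_pos),
          mem_nhdsWithin_of_mem_nhds (ge_mem_nhds hy)] with x h1 h2 h3
        exact ⟨h1, fun ξ hξ _ => hk' x h1 h2 h3 ξ hξ⟩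
  refine tendsto_zero_iff_enorm_tendsto_zero.2 ?_
  refine tendsto_of_tendsto_of_tendsto_of_le_of_le' tendsto_const_nhds hlim
    (Eventually.of_forall fun _ => zero_le) ?_
  filter_upwards [hpos] with x hx
  exact enorm_translation_le ha hx hy f

end IndexWhittaker

theorem mainTheorem6 (a : ℝ) (ha : 0 ≤ a) (y : ℝ) (hy : 0 < y) :
    -- (a) the order interval `0 ≤ f ≤ 1` is preserved
    (∀ f : ℝ → ℝ, MemLp f ∞ (IndexWhittaker.measureM a) →
      (∀ᵐ ξ ∂(IndexWhittaker.measureM a), 0 ≤ f ξ ∧ f ξ ≤ 1) →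
      ∀ x : ℝ, 0 < x →
        0 ≤ IndexWhittaker.translation a y f x ∧ IndexWhittaker.translation a y f x ≤ 1) ∧
    -- (b) well-definedness and contractivity on `L_p^a`, `1 ≤ p ≤ ∞`
    (∀ p : ℝ≥0∞, 1 ≤ p → ∀ f : ℝ → ℂ, MemLp f p (IndexWhittaker.measureM a) →
      (∀ᵐ x ∂(IndexWhittaker.measureM a),
        Integrable (fun ξ => IndexWhittaker.kernelQ a x y ξ • f ξ) (IndexWhittaker.measureM a)) ∧
      MemLp (IndexWhittaker.translation a y f) p (IndexWhittaker.measureM a) ∧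
      eLpNorm (IndexWhittaker.translation a y f) p (IndexWhittaker.measureM a) ≤
        eLpNorm f p (IndexWhittaker.measureM a)) ∧
    -- (c) continuity of `T_a^y f` for `1 < p ≤ ∞`
    (∀ p : ℝ≥0∞, 1 < p → ∀ f : ℝ → ℂ, MemLp f p (IndexWhittaker.measureM a) →
      (∀ x : ℝ, 0 < x →
        Integrable (fun ξ => IndexWhittaker.kernelQ a x y ξ • f ξ) (IndexWhittaker.measureM a)) ∧
      ContinuousOn (IndexWhittaker.translation a y f) (Ioi 0)) ∧
    -- (c) `L_p`-continuity in `y` for `1 < p < ∞`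
    (∀ p : ℝ≥0∞, 1 < p → p < ∞ → ∀ f : ℝ → ℂ, MemLp f p (IndexWhittaker.measureM a) →
      Tendsto (fun h : ℝ =>
          eLpNorm (fun x => IndexWhittaker.translation a (y + h) f x -
            IndexWhittaker.translation a y f x) p (IndexWhittaker.measureM a))
        (𝓝 0) (𝓝 0)) ∧
    -- (d) the limit at infinity
    (∀ f : ℝ → ℂ, ContinuousOn f (Ioi 0) → (∃ M : ℝ, ∀ x : ℝ, 0 < x → ‖f x‖ ≤ M) →
      Tendsto (IndexWhittaker.translation a y f) atTop (𝓝 (f y))) ∧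
    -- (e) the limit at zero
    (∀ f : ℝ → ℂ, MemLp f ∞ (IndexWhittaker.measureM a) →
      Tendsto f (𝓝[>] 0) (𝓝 0) →
      Tendsto (IndexWhittaker.translation a y f) (𝓝[>] 0) (𝓝 0)) := by
  refine ⟨fun f _ hf x hx => IndexWhittaker.translation_mem_Icc ha hx hy hf,
    fun p hp f hf => ⟨IndexWhittaker.ae_integrable_kernelQ_smul ha hy hp hf,
      ⟨IndexWhittaker.aestronglyMeasurable_translation ha hf.1,
        (IndexWhittaker.eLpNorm_translation_le ha hy hp hf.1).trans_lt hf.2⟩,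
      IndexWhittaker.eLpNorm_translation_le ha hy hp hf.1⟩,
    fun p hp f hf => ⟨fun x hx => IndexWhittaker.integrable_kernelQ_smul ha hx hy hp hf,
      fun x hx => (IndexWhittaker.continuousAt_translation ha hx hy hp hf).continuousWithinAt⟩,
    fun p hp hpt f hf => IndexWhittaker.tendsto_eLpNorm_translation ha hy hp hpt.ne hf,
    fun f hf hb => IndexWhittaker.tendsto_translation_atTop ha hy hf hb,
    fun f hf hf0 => IndexWhittaker.tendsto_translation_zero ha hy hf hf0⟩
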